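/- **Theorem ($L^1$-convergence of $\{G_t\}$).** Let $\mathcal S$ and $\mathcal A$ be finite sets of states and actions, let $p(s'\mid s,a)$ be transition probabilities, and let $\pi(a\mid s)$ and $\pi^o(a\mid s)$ be two stationary policies (the target and the behavior policy). Let $\gamma,\lambda:\mathcal S\to[0,1]$, $i:\mathcal S\to[0,\infty)$ and $\phi:\mathcal S\to\mathbb R^n$ be given functions, and put $\rho(s,a)=\pi(a\mid s)/\pi^o(a\mid s)$ with $0/0=0$. For a policy $q$ write $P_q$ for the matrix with entries $P_q(s,s')=\sum_a q(a\mid s)\,p(s'\mid s,a)$, and let $\Gamma$ be the diagonal matrix with diagonal entries $\gamma(s)$. Assume: - $I-P_\pi\Gamma$ is invertible; - $P_{\pi^o}$ is irreducible, and $\pi^o(a\mid s)>0$ whenever $\pi(a\mid s)>0$. Let $\{(S_t,A_t)\}_{t\ge 0}$ be the Markov chain on $\mathcal S\times\mathcal A$ generated by the behavior policy: it moves from $(s,a)$ to $(s',a')$ with probability $p(s'\mid s,a)\,\pi^o(a'\mid s')$, and the law of $(S_0,A_0)$ is arbitrary. Given an initial $Y_0=(e_0,F_0)\in\mathbb R^n\times\mathbb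 R$, let $Y_t=(e_t,F_t)$ be defined for $t\ge1$ by $$F_t=\gamma(S_t)\,\rho(S_{t-1},A_{t-1})\,F_{t-1}+i(S_t),\qquad M_t=\lambda(S_t)\,i(S_t)+(1-\lambda(S_t))\,F_t,$$ $$e_t=\lambda(S_t)\,\gamma(S_t)\,\rho(S_{t-1},A_{t-1})\,e_{t-1}+M_t\,\phi(S_t).$$ Let $\|\cdot\|$ be the maximum norm, and let $h:\mathbb R^{n+1}\times\mathcal S\times\mathcal A\times\mathcal S\to\mathbb R^m$ be such that for some constant $L_h$, $\|h(y,s,a,s')-h(\hat y,s,a,s')\|\le L_h\|y-\hat y\|$ for all $y,\hat y\in\mathbb R^{n+1}$ and all $(s,a,s')$. For a deterministic stepsize sequence $\{\alpha_t\}$ and an initial $G_0\in\mathbb R^m$, let $$G_{t+1}=(1-\alpha_t)\,G_t+\alpha_t\,h(Y_t,S_t,A_t,S_{t+1}),\qquad t\ge0.$$ Then there exists a constant vector $G^*\in\mathbb R^m$, which depends neither on the stepsizes nor on the initial conditions, such that for every eventually nonincreasing sequence of stepsizes $\alpha_t\in(0,1]$ with $\sum_t\alpha_t=\infty$ and $\sum_t\alpha_t^2<\infty$,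 for every law of $(S_0,A_0)$, and for every given $Y_0=(e_0,F_0)$ and $G_0$, all $G_t$ are integrable and $$\lim_{t\to\infty}\mathbb E\big[\|G_t-G^*\|\big]=0.$$ -/

import Mathlib

open MeasureTheory Filter Topology

/-- A finite Markov decision process with state space `S` and action set `A`, a target policy and a
behavior policy, and the functions used by the emphatic temporal-difference traces with
`n`-dimensional features. -/
structure EmphaticModel (S A : Type*) [Fintype S] [Fintype A] (n : ℕ) where
  /-- `trans s a s'` is the probability `p(s' | s, a)`. -/
  trans : S → A → S → ℝ
  trans_mem : ∀ s a, trans s a ∈ stdSimplex ℝ S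
  /-- `target s a` is the probability `π(a | s)` of the target policy. -/
  target : S → A → ℝ
  target_mem : ∀ s, target s ∈ stdSimplex ℝ A
  /-- `behavior s a` is the probability `π°(a | s)` of the behavior policy. -/
  behavior : S → A → ℝ
  behavior_mem : ∀ s, behavior s ∈ stdSimplex ℝ A
  /-- State-dependent discount factors; `1 - gam s` is the termination probability at `s`. -/
  gam : S → ℝ
  gam_mem : ∀ s, gam s ∈ Set.Icc (0 : ℝ) 1
  /-- State-dependent trace parameters. -/
  lam : S → ℝ
  lam_mem : ∀ s, lam s ∈ Set.Icc (0 : ℝ) 1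
  /-- Interest weights `i(s)`. -/
  interest : S → ℝ
  interest_nonneg : ∀ s, 0 ≤ interest s
  /-- Feature vectors. -/
  feature : S → Fin n → ℝ

/-- Values of the trace pair `y = (e, F)` in `ℝⁿ × ℝ`. The norm is the maximum norm. -/
abbrev TraceSpace (n : ℕ) : Type := (Fin n → ℝ) × ℝ

namespace EmphaticModel

variable {S A : Type*} [Fintype S] [Fintype A] {n : ℕ}

/-- Transition matrix on the states induced by a stationary policy `q`. -/
def policyMatrix (M : EmphaticModel S A n) (q : S → A → ℝ) : Matrix S S ℝ :=
  Matrix.of fun s s' => ∑ a, q s a * M.trans s a s'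

/-- Likelihood ratios `ρ(s, a) = π(a | s) / π°(a | s)`, with `0 / 0 = 0`. -/
noncomputable def ratio (M : EmphaticModel S A n) (s : S) (a : A) : ℝ :=
  M.target s a / M.behavior s a

/-- Conditions on the policies: `I - P_π Γ` is invertible; the behavior policy induces an
irreducible chain on the states, and takes with positive probability every action that the target
policy takes with positive probability. -/
structure PolicyCondition [DecidableEq S] (M : EmphaticModel S A n) : Prop where
  isUnit : IsUnit (1 - M.policyMatrix M.target * Matrix.diagonal M.gam)
  irreducible : (M.policyMatrix M.behavior).IsIrreducible
  coverage : ∀ s a, 0 < M.target s a → 0 < M.behavior s a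

/-- The states `St t` and actions `Ac t` form a Markov chain, with an arbitrary law of
`(St 0, Ac 0)`, which moves from `(s, a)` to `(s', a')` with probability
`p(s' | s, a) π°(a' | s')`. -/
structure IsBehaviorChain [MeasurableSpace S] [MeasurableSpace A] (M : EmphaticModel S A n)
    {Ω : Type*} [MeasurableSpace Ω] (μ : Measure Ω)
    (St : ℕ → Ω → S) (Ac : ℕ → Ω → A) : Prop where
  measurable_state : ∀ t, Measurable (St t)
  measurable_action : ∀ t, Measurable (Ac t)
  transition : ∀ (t : ℕ) (s : ℕ → S) (a : ℕ → A),
    μ.real {ω | ∀ k ≤ t + 1, St k ω = s k ∧ Ac k ω = a k} =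
      μ.real {ω | ∀ k ≤ t, St k ω = s k ∧ Ac k ω = a k} *
        (M.trans (s t) (a t) (s (t + 1)) * M.behavior (s (t + 1)) (a (t + 1)))

/-- The follow-on trace `F_t = γ_t ρ_{t-1} F_{t-1} + i(S_t)` along a path, from `F_0`. -/
noncomputable def followOn (M : EmphaticModel S A n) (F₀ : ℝ) (s : ℕ → S) (a : ℕ → A) : ℕ → ℝ
  | 0 => F₀
  | t + 1 => M.gam (s (t + 1)) * M.ratio (s t) (a t) * M.followOn F₀ s a t + M.interest (s (t + 1))

/-- The emphasis weight `M_t = λ_t i(S_t) + (1 - λ_t) F_t` along a path. -/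
noncomputable def emphasis (M : EmphaticModel S A n) (F₀ : ℝ) (s : ℕ → S) (a : ℕ → A)
    (t : ℕ) : ℝ :=
  M.lam (s t) * M.interest (s t) + (1 - M.lam (s t)) * M.followOn F₀ s a t

/-- The eligibility trace `e_t = λ_t γ_t ρ_{t-1} e_{t-1} + M_t φ(S_t)` along a path, from `e_0`. -/
noncomputable def eligibility (M : EmphaticModel S A n) (e₀ : Fin n → ℝ) (F₀ : ℝ)
    (s : ℕ → S) (a : ℕ → A) : ℕ → Fin n → ℝ
  | 0 => e₀
  | t + 1 =>
      (M.lam (s (t + 1)) * M.gam (s (t + 1)) * M.ratio (s t) (a t)) • M.eligibility e₀ F₀ s a t +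
        M.emphasis F₀ s a (t + 1) • M.feature (s (t + 1))

/-- The pair of traces `Y_t = (e_t, F_t)` along a path, from `Y_0 = y₀`. -/
noncomputable def traces (M : EmphaticModel S A n) (y₀ : TraceSpace n) (s : ℕ → S) (a : ℕ → A)
    (t : ℕ) : TraceSpace n :=
  (M.eligibility y₀.1 y₀.2 s a t, M.followOn y₀.2 s a t)

/-- The averaging recursion `G_{t+1} = (1 - α_t) G_t + α_t h(Y_t, S_t, A_t, S_{t+1})` along a path,
from `G_0 = g₀` and `Y_0 = y₀`. -/
noncomputable def averaging (M : EmphaticModel S A n) {m : ℕ}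
    (h : TraceSpace n → S → A → S → Fin m → ℝ) (α : ℕ → ℝ) (y₀ : TraceSpace n) (g₀ : Fin m → ℝ)
    (s : ℕ → S) (a : ℕ → A) : ℕ → Fin m → ℝ
  | 0 => g₀
  | t + 1 => (1 - α t) • M.averaging h α y₀ g₀ s a t +
      α t • h (M.traces y₀ s a t) (s t) (a t) (s (t + 1))

end EmphaticModel

/-- Deterministic stepsizes in `(0, 1]`, eventually nonincreasing, with divergent sum and summable
squares. -/
structure StepsizeCondition (α : ℕ → ℝ) : Prop where
  mem : ∀ t, α t ∈ Set.Ioc (0 : ℝ) 1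
  eventually_antitone : ∃ T, AntitoneOn α (Set.Ici T)
  sum_diverges : Tendsto (fun t => ∑ k ∈ Finset.range t, α k) atTop atTop
  summable_sq : Summable fun t => α t ^ 2

/-! The products of the factors `γ ρ` can make the traces large. The proof bounds them uniformly in
time only in first moment, so second-moment arguments are reserved for bounded functionals, and
everything else is done in `L¹`.

Fix `K` and restart the traces from zero `K + 1` steps before the present. The input then becomes a
bounded function of finitely many consecutive state-action pairs. For such a window function the
averages converge in `L¹` to a constant `c K` (`PolicyCondition.exists_averagesTo_window`): the
Poisson equation and one-step conditional means split it into a constant, a forward difference and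
martingale differences. Forward differences average out by summation by parts, which uses that the
stepsizes are eventually monotone (`averagesTo_forward_sub`). Martingale differences average out by
orthogonality and the summable squares (`averagesTo_of_orthogonal`). Only constancy of harmonic
functions is needed, so periodicity does no harm.

The restart costs an `L¹` error of order `θ ^ K`, uniformly in time
(`IsBehaviorChain.exists_traces_bound`). Invertibility of `I - P_π Γ` yields a function `V ≥ 1` with
`V = 1 + P_π Γ V`, hence a Lyapunov function that contracts on average under multiplication by `γ
ρ`. The Lipschitz condition carries this error over to the input.

The averages are thus within `O(θ ^ K)` of `c K` for every `K`. This makes `c` a Cauchy sequence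
whose limit is the desired constant. Each `c K` comes from the model and the input function alone,
hence so does the limit. -/

/-! ### Scalar recursions and weighted averages -/

/-- A recursive inequality with divergent stepsizes forgets its start and its summable
perturbations. -/
theorem eventually_le_of_recursion {α x β : ℕ → ℝ} {ε : ℝ}
    (hα : ∀ t, α t ∈ Set.Ioc (0 : ℝ) 1)
    (hsum : Tendsto (fun t => ∑ k ∈ Finset.range t, α k) atTop atTop)
    (hβ : Summable β) (hβ0 : ∀ t, 0 ≤ β t)
    (hx : ∀ t, x (t + 1) ≤ (1 - α t) * x t + α t * ε + β t) :
    ∀ δ > 0, ∀ᶠ t in atTop, x t ≤ ε + δ := by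
  intro δ hδ
  obtain ⟨T, hT⟩ : ∃ T, ∑' k, β (k + T) < δ / 2 :=
    ((tendsto_order.1 (tendsto_sum_nat_add β)).2 _ (half_pos hδ)).exists
  have hβT : Summable fun k => β (k + T) :=
    (summable_nat_add_iff (G := ℝ) T).2 hβ
  -- Unrolled from time `T`, where the remaining perturbations total less than `δ / 2`; the bound `1
  -- - α ≤ exp (-α)` turns the product of contraction factors into an exponential.
  have key : ∀ n, x (n + T) - ε ≤
      Real.exp (-∑ k ∈ Finset.range n, α (k + T)) * |x T - ε| +
        ∑ k ∈ Finset.range n, β (k + T) := by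
    intro n
    induction n with
    | zero => simpa using le_abs_self (x T - ε)
    | succ n ih =>
      have h1 := hx (n + T)
      have ha := hα (n + T)
      have h2 : 1 - α (n + T) ≤ Real.exp (-α (n + T)) := Real.one_sub_le_exp_neg _
      have hB : 0 ≤ ∑ k ∈ Finset.range n, β (k + T) := Finset.sum_nonneg fun k _ => hβ0 _
      rw [Finset.sum_range_succ, Finset.sum_range_succ, neg_add, Real.exp_add,
        show n + 1 + T = n + T + 1 by ring]
      set E := Real.exp (-∑ k ∈ Finset.range n, α (k + T))
      set B := ∑ k ∈ Finset.range n, β (k + T)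
      have hE : 0 ≤ E * |x T - ε| := by positivity
      have h3 := mul_le_mul_of_nonneg_left ih (sub_nonneg.2 ha.2)
      have h4 := mul_le_mul_of_nonneg_right h2 hE
      have h5 : 0 ≤ α (n + T) * B := mul_nonneg ha.1.le hB
      linarith
  have hlim : Tendsto (fun n => Real.exp (-∑ k ∈ Finset.range n, α (k + T)) * |x T - ε|)
      atTop (𝓝 0) := by
    have h1 : Tendsto (fun n => ∑ k ∈ Finset.range n, α (k + T)) atTop atTop := by
      have h2 := tendsto_atTop_add_const_right _ (-∑ k ∈ Finset.range T, α k)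
        ((tendsto_add_atTop_iff_nat T).2 hsum)
      refine h2.congr fun n => ?_
      rw [add_comm n T, Finset.sum_range_add]
      simp [add_comm]
    simpa using (Real.tendsto_exp_neg_atTop_nhds_zero.comp h1).mul_const (|x T - ε|)
  have hev := hlim.eventually (gt_mem_nhds (half_pos hδ))
  have hev' : ∀ᶠ n in atTop, x (n + T) ≤ ε + δ := by
    filter_upwards [hev] with n hn
    have := hβT.sum_le_tsum (Finset.range n) (fun k _ => hβ0 _)
    have := key n
    linarith
  obtain ⟨N, hN⟩ := eventually_atTop.1 hev'
  refine eventually_atTop.2 ⟨N + T, fun t ht => ?_⟩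
  have := hN (t - T) (by omega)
  rwa [Nat.sub_add_cancel (by omega)] at this

/-- The averages `g_{t+1} = (1 - α_t) g_t + α_t x_t`. -/
def weightedAvg (α : ℕ → ℝ) (g : ℝ) (x : ℕ → ℝ) : ℕ → ℝ
  | 0 => g
  | t + 1 => (1 - α t) * weightedAvg α g x t + α t * x t

theorem weightedAvg_add (α : ℕ → ℝ) (g g' : ℝ) (x x' : ℕ → ℝ) (t : ℕ) :
    weightedAvg α (g + g') (fun k => x k + x' k) t =
      weightedAvg α g x t + weightedAvg α g' x' t := by
  induction t with
  | zero => rfl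
  | succ t ih => simp only [weightedAvg, ih]; ring

theorem weightedAvg_congr {α : ℕ → ℝ} {g : ℝ} {x x' : ℕ → ℝ} {t : ℕ}
    (h : ∀ k < t, x k = x' k) : weightedAvg α g x t = weightedAvg α g x' t := by
  induction t with
  | zero => rfl
  | succ t ih =>
    simp only [weightedAvg, ih fun k hk => h k (by omega), h t (by omega)]

/-! ### Convergence of averages in `L¹` up to an error -/

section L1

variable {Ω : Type*} [MeasurableSpace Ω] {μ : Measure Ω}

theorem integrable_weightedAvg [IsFiniteMeasure μ] {α : ℕ → ℝ} {X : ℕ → Ω → ℝ}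
    (hX : ∀ t, Integrable (X t) μ) (g : ℝ) (t : ℕ) :
    Integrable (fun ω => weightedAvg α g (fun k => X k ω) t) μ := by
  induction t with
  | zero => exact integrable_const g
  | succ t ih => exact (ih.const_mul _).add ((hX t).const_mul _)

/-- In `L¹(μ)`, the averages of `X` are eventually within any distance larger than `ε` from `c`,
whatever their start. -/
def AveragesTo (μ : Measure Ω) (α : ℕ → ℝ) (X : ℕ → Ω → ℝ) (c ε : ℝ) : Prop :=
  ∀ g δ : ℝ, 0 < δ →
    ∀ᶠ t in atTop, ∫ ω, |weightedAvg α g (fun k => X k ω) t - c| ∂μ ≤ ε + δ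

theorem AveragesTo.add [IsFiniteMeasure μ] {α : ℕ → ℝ} {X Y : ℕ → Ω → ℝ} {c d ε η : ℝ}
    (hX : ∀ t, Integrable (X t) μ) (hY : ∀ t, Integrable (Y t) μ)
    (h : AveragesTo μ α X c ε) (h' : AveragesTo μ α Y d η) :
    AveragesTo μ α (fun t ω => X t ω + Y t ω) (c + d) (ε + η) := by
  intro g δ hδ
  filter_upwards [h g _ (half_pos hδ), h' 0 _ (half_pos hδ)] with t h1 h2
  have i1 := ((integrable_weightedAvg (α := α) hX g t).sub (integrable_const c)).abs
  have i2 := ((integrable_weightedAvg (α := α) hY 0 t).sub (integrable_const d)).abs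
  have h3 : ∫ ω, |weightedAvg α g (fun k => X k ω + Y k ω) t - (c + d)| ∂μ ≤
      ∫ ω, (|weightedAvg α g (fun k => X k ω) t - c| +
        |weightedAvg α 0 (fun k => Y k ω) t - d|) ∂μ := by
    refine integral_mono_of_nonneg (ae_of_all _ fun ω => abs_nonneg _) (i1.add i2)
      (ae_of_all _ fun ω => ?_)
    have := weightedAvg_add α g 0 (fun k => X k ω) (fun k => Y k ω) t
    rw [add_zero] at this
    simp only [this]
    rw [add_sub_add_comm]
    exact abs_add_le _ _
  have h4 := integral_add i1 i2
  simp only [Pi.sub_apply] at h4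
  rw [h4] at h3
  linarith

/-- Both constants are compared with the same average at one late time. This is what later makes the
limits of the window approximations a Cauchy sequence. -/
theorem AveragesTo.unique [IsProbabilityMeasure μ] {α : ℕ → ℝ} {X : ℕ → Ω → ℝ} {c d ε η : ℝ}
    (hX : ∀ t, Integrable (X t) μ)
    (h : AveragesTo μ α X c ε) (h' : AveragesTo μ α X d η) : |c - d| ≤ ε + η := by
  refine le_of_forall_pos_le_add fun δ hδ => ?_
  obtain ⟨t, h1, h2⟩ := ((h 0 _ (half_pos hδ)).and (h' 0 _ (half_pos hδ))).exists
  have i1 := ((integrable_weightedAvg (α := α) hX 0 t).sub (integrable_const c)).abs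
  have i2 := ((integrable_weightedAvg (α := α) hX 0 t).sub (integrable_const d)).abs
  have h3 : ∫ _, |c - d| ∂μ ≤
      ∫ ω, (|weightedAvg α 0 (fun k => X k ω) t - c| +
        |weightedAvg α 0 (fun k => X k ω) t - d|) ∂μ := by
    refine integral_mono (integrable_const _) (i1.add i2) fun ω => ?_
    simp only
    rw [abs_sub_comm (weightedAvg α 0 (fun k => X k ω) t) c, ← Real.dist_eq, ← Real.dist_eq,
      ← Real.dist_eq]
    exact dist_triangle _ _ _
  have h4 := integral_add i1 i2
  simp only [Pi.sub_apply] at h4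
  rw [h4] at h3
  simp at h3
  linarith

theorem AveragesTo.congr_fun {α : ℕ → ℝ} {X Y : ℕ → Ω → ℝ} {c ε : ℝ}
    (h : AveragesTo μ α X c ε) (hXY : ∀ t ω, Y t ω = X t ω) : AveragesTo μ α Y c ε := by
  obtain rfl : Y = X := funext fun t => funext (hXY t)
  exact h

/-- By convexity, the `L¹` distance of the average from `c` satisfies the scalar recursion without
perturbation. A uniform `L¹` error of the inputs thus passes to the averages, with no assumption on
their dependence. -/
theorem averagesTo_of_integral_abs_sub_le [IsFiniteMeasure μ] {α : ℕ → ℝ}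
    (hα : StepsizeCondition α) {X : ℕ → Ω → ℝ} {c ε : ℝ} (hX : ∀ t, Integrable (X t) μ)
    (h : ∀ t, ∫ ω, |X t ω - c| ∂μ ≤ ε) : AveragesTo μ α X c ε := by
  intro g δ hδ
  refine eventually_le_of_recursion (β := fun _ => 0) hα.mem hα.sum_diverges summable_zero
    (fun _ => le_rfl) (fun t => ?_) δ hδ
  have i1 := ((integrable_weightedAvg (α := α) hX g t).sub (integrable_const c)).abs
  have i2 := ((hX t).sub (integrable_const c)).abs
  have ha := hα.mem t
  have h3 : ∫ ω, |weightedAvg α g (fun k => X k ω) (t + 1) - c| ∂μ ≤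
      ∫ ω, ((1 - α t) * |weightedAvg α g (fun k => X k ω) t - c| + α t * |X t ω - c|) ∂μ := by
    refine integral_mono_of_nonneg (ae_of_all _ fun ω => abs_nonneg _)
      ((i1.const_mul _).add (i2.const_mul _)) (ae_of_all _ fun ω => ?_)
    simp only [weightedAvg]
    calc _ = |(1 - α t) * (weightedAvg α g (fun k => X k ω) t - c) + α t * (X t ω - c)| := by
          congr 1; ring
      _ ≤ _ := by
          refine (abs_add_le _ _).trans_eq ?_
          rw [abs_mul, abs_mul, abs_of_nonneg (sub_nonneg.2 ha.2), abs_of_nonneg ha.1.le]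
  have h4 := integral_add (i1.const_mul (1 - α t)) (i2.const_mul (α t))
  simp only [Pi.sub_apply] at h4
  rw [h4, integral_const_mul, integral_const_mul] at h3
  have h5 := mul_le_mul_of_nonneg_left (h t) ha.1.le
  linarith

theorem AveragesTo.of_dist [IsProbabilityMeasure μ] {α : ℕ → ℝ} {X : ℕ → Ω → ℝ} {c ε : ℝ}
    (h : AveragesTo μ α X c ε) (hX : ∀ t, Integrable (X t) μ) (hα : StepsizeCondition α) (d : ℝ) :
    AveragesTo μ α X d (ε + |c - d|) := by
  have h1 : AveragesTo μ α (fun _ _ => 0 : ℕ → Ω → ℝ) (d - c) |c - d| :=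
    averagesTo_of_integral_abs_sub_le hα (fun _ => integrable_const 0) fun t => by simp
  simpa using h.add hX (fun _ => integrable_const 0) h1

theorem AveragesTo.tendsto {α : ℕ → ℝ} {X : ℕ → Ω → ℝ} {c : ℝ} (h : AveragesTo μ α X c 0)
    (g : ℝ) :
    Tendsto (fun t => ∫ ω, |weightedAvg α g (fun k => X k ω) t - c| ∂μ) atTop (𝓝 0) := by
  refine tendsto_order.2 ⟨fun a ha => Eventually.of_forall fun t =>
    ha.trans_le (integral_nonneg fun ω => abs_nonneg _), fun a ha => ?_⟩
  filter_upwards [h g (a / 2) (half_pos ha)] with t ht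
  linarith

/-- Once the stepsizes are monotone, their variation telescopes. -/
theorem StepsizeCondition.summable_abs_sub {α : ℕ → ℝ} (hα : StepsizeCondition α) :
    Summable fun t => |α t - α (t + 1)| := by
  obtain ⟨T, hT⟩ := hα.eventually_antitone
  rw [← summable_nat_add_iff T]
  refine summable_of_sum_range_le (c := α T) (fun _ => abs_nonneg _) fun n => ?_
  have h1 : ∀ k, |α (k + T) - α (k + T + 1)| = α (k + T) - α (k + 1 + T) := fun k => by
    rw [show k + T + 1 = k + 1 + T by ring]
    exact abs_of_nonneg (sub_nonneg.2 (hT (Set.mem_Ici.2 (by omega)) (Set.mem_Ici.2 (by omega))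
      (by omega)))
  simp only [h1]
  rw [Finset.sum_range_sub' (fun k => α (k + T))]
  have := (hα.mem (n + T)).1
  simp only [zero_add]
  linarith

theorem StepsizeCondition.tendsto_zero {α : ℕ → ℝ} (hα : StepsizeCondition α) :
    Tendsto α atTop (𝓝 0) := by
  have h := hα.summable_sq.tendsto_atTop_zero.sqrt
  simp only [Real.sqrt_zero] at h
  exact h.congr fun t => Real.sqrt_sq (hα.mem t).1.le

/-- Summation by parts. With `H` the average, `u t = H t - α t * X t` satisfies `u (t+1) = (1 - α t)
u t - α t ^ 2 X t + (α t - α (t+1)) X (t+1)`. Both perturbations are summable in `L¹`, and the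
correction `α t * X t` vanishes because `α` tends to zero. -/
theorem averagesTo_forward_sub [IsFiniteMeasure μ] {α : ℕ → ℝ}
    (hα : StepsizeCondition α) {X : ℕ → Ω → ℝ} {C : ℝ} (hX : ∀ t, Integrable (X t) μ)
    (h : ∀ t, ∫ ω, |X t ω| ∂μ ≤ C) :
    AveragesTo μ α (fun t ω => X (t + 1) ω - X t ω) 0 0 := by
  intro g δ hδ
  have hC : 0 ≤ C := (integral_nonneg fun ω => abs_nonneg _).trans (h 0)
  set H : ℕ → Ω → ℝ := fun t ω => weightedAvg α g (fun k => X (k + 1) ω - X k ω) t with hH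
  have iH : ∀ t, Integrable (H t) μ :=
    integrable_weightedAvg (X := fun t ω => X (t + 1) ω - X t ω)
      (fun t => (hX (t + 1)).sub (hX t)) g
  have iu : ∀ t, Integrable (fun ω => |H t ω - α t * X t ω|) μ := fun t =>
    ((iH t).sub ((hX t).const_mul _)).abs
  have hu : ∀ δ > 0, ∀ᶠ t in atTop, ∫ ω, |H t ω - α t * X t ω| ∂μ ≤ 0 + δ := by
    refine eventually_le_of_recursion (β := fun t => α t ^ 2 * C + |α t - α (t + 1)| * C)
      hα.mem hα.sum_diverges
      ((hα.summable_sq.mul_right C).add (hα.summable_abs_sub.mul_right C))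
      (fun t => by positivity) fun t => ?_
    have ha := hα.mem t
    have i3 := ((iu t).const_mul (1 - α t)).add (((hX t).abs.const_mul (α t ^ 2)).add
      ((hX (t + 1)).abs.const_mul |α t - α (t + 1)|))
    have h3 : ∫ ω, |H (t + 1) ω - α (t + 1) * X (t + 1) ω| ∂μ ≤
        ∫ ω, ((1 - α t) * |H t ω - α t * X t ω| + (α t ^ 2 * |X t ω| +
          |α t - α (t + 1)| * |X (t + 1) ω|)) ∂μ := by
      refine integral_mono_of_nonneg (ae_of_all _ fun ω => abs_nonneg _) i3
        (ae_of_all _ fun ω => ?_)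
      calc |H (t + 1) ω - α (t + 1) * X (t + 1) ω|
          = |(1 - α t) * (H t ω - α t * X t ω) + (-(α t ^ 2 * X t ω) +
              (α t - α (t + 1)) * X (t + 1) ω)| := by
            simp only [hH, weightedAvg]; congr 1; ring
        _ ≤ |(1 - α t) * (H t ω - α t * X t ω)| + (|-(α t ^ 2 * X t ω)| +
              |(α t - α (t + 1)) * X (t + 1) ω|) :=
            (abs_add_le _ _).trans (add_le_add le_rfl (abs_add_le _ _))
        _ = _ := by
            rw [abs_neg, abs_mul, abs_mul, abs_mul, abs_of_nonneg (sub_nonneg.2 ha.2),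
              abs_of_nonneg (sq_nonneg (α t))]
    rw [integral_add ((iu t).const_mul _) (((hX t).abs.const_mul (α t ^ 2)).fun_add
        ((hX (t + 1)).abs.const_mul |α t - α (t + 1)|)),
      integral_add ((hX t).abs.const_mul (α t ^ 2))
        ((hX (t + 1)).abs.const_mul |α t - α (t + 1)|),
      integral_const_mul, integral_const_mul, integral_const_mul] at h3
    have h5 := mul_le_mul_of_nonneg_left (h t) (sq_nonneg (α t))
    have h6 := mul_le_mul_of_nonneg_left (h (t + 1)) (abs_nonneg (α t - α (t + 1)))
    linarith
  have hαC : ∀ᶠ t in atTop, α t * C < δ / 2 := by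
    have := hα.tendsto_zero.mul_const C
    rw [zero_mul] at this
    exact this.eventually (gt_mem_nhds (half_pos hδ))
  filter_upwards [hu _ (half_pos hδ), hαC] with t h1 h2
  have ha := hα.mem t
  have h3 : ∫ ω, |H t ω - 0| ∂μ ≤ ∫ ω, (|H t ω - α t * X t ω| + α t * |X t ω|) ∂μ := by
    refine integral_mono_of_nonneg (ae_of_all _ fun ω => abs_nonneg _)
      ((iu t).add ((hX t).abs.const_mul _)) (ae_of_all _ fun ω => ?_)
    calc |H t ω - 0| = |(H t ω - α t * X t ω) + α t * X t ω| := by congr 1; ring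
      _ ≤ _ := (abs_add_le _ _).trans_eq (by rw [abs_mul (α t), abs_of_nonneg ha.1.le])
  rw [integral_add (iu t) ((hX t).abs.const_mul _), integral_const_mul] at h3
  have h5 := mul_le_mul_of_nonneg_left (h t) ha.1.le
  linarith

/-- A time shift changes the input by a forward difference, which averages to zero. -/
theorem AveragesTo.of_succ [IsFiniteMeasure μ] {α : ℕ → ℝ}
    (hα : StepsizeCondition α) {X : ℕ → Ω → ℝ} {C c ε : ℝ} (hX : ∀ t, Integrable (X t) μ)
    (h : ∀ t, ∫ ω, |X t ω| ∂μ ≤ C) (hs : AveragesTo μ α (fun t => X (t + 1)) c ε) :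
    AveragesTo μ α X c ε := by
  have h1 := averagesTo_forward_sub hα (X := fun t ω => -X t ω) (fun t => (hX t).neg)
    (by simpa using h)
  have h2 := hs.add (fun t => hX (t + 1)) (fun t => ((hX (t + 1)).neg.sub (hX t).neg)) h1
  simpa using h2

theorem AveragesTo.to_succ [IsFiniteMeasure μ] {α : ℕ → ℝ}
    (hα : StepsizeCondition α) {X : ℕ → Ω → ℝ} {C c ε : ℝ} (hX : ∀ t, Integrable (X t) μ)
    (h : ∀ t, ∫ ω, |X t ω| ∂μ ≤ C) (hs : AveragesTo μ α X c ε) :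
    AveragesTo μ α (fun t => X (t + 1)) c ε := by
  have h1 := averagesTo_forward_sub hα hX h
  have h2 := hs.add hX (fun t => (hX (t + 1)).sub (hX t)) h1
  simpa using h2

theorem AveragesTo.add_nat [IsFiniteMeasure μ] {α : ℕ → ℝ}
    (hα : StepsizeCondition α) {X : ℕ → Ω → ℝ} {C c ε : ℝ} (hX : ∀ t, Integrable (X t) μ)
    (h : ∀ t, ∫ ω, |X t ω| ∂μ ≤ C) (hs : AveragesTo μ α X c ε) (K : ℕ) :
    AveragesTo μ α (fun t => X (t + K)) c ε := by
  induction K with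
  | zero => simpa using hs
  | succ K ih =>
    have := ih.to_succ hα (X := fun t => X (t + K)) (fun t => hX (t + K)) (fun t => h (t + K))
    simpa only [add_right_comm _ 1 K, add_assoc, add_comm 1 K] using this

theorem AveragesTo.of_add_nat [IsFiniteMeasure μ] {α : ℕ → ℝ}
    (hα : StepsizeCondition α) {X : ℕ → Ω → ℝ} {C c ε : ℝ} (hX : ∀ t, Integrable (X t) μ)
    (h : ∀ t, ∫ ω, |X t ω| ∂μ ≤ C) (K : ℕ) (hs : AveragesTo μ α (fun t => X (t + K)) c ε) :
    AveragesTo μ α X c ε := by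
  induction K with
  | zero => simpa using hs
  | succ K ih =>
    refine ih (AveragesTo.of_succ hα (X := fun t => X (t + K)) (fun t => hX (t + K)) (fun t => h (t + K)) ?_)
    simpa only [add_assoc, add_comm 1 K] using hs

/-- Orthogonality removes the cross term from the square of the recursion, so the second moment of
the average obeys the scalar recursion with perturbation `α t ^ 2 * C`. -/
theorem averagesTo_of_orthogonal [IsProbabilityMeasure μ] {α : ℕ → ℝ}
    (hα : StepsizeCondition α) {D : ℕ → Ω → ℝ} {C : ℝ}
    (hD2 : ∀ t, Integrable (fun ω => D t ω ^ 2) μ)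
    (hH2 : ∀ g t, Integrable (fun ω => weightedAvg α g (fun k => D k ω) t ^ 2) μ)
    (hHD : ∀ g t, Integrable (fun ω => weightedAvg α g (fun k => D k ω) t * D t ω) μ)
    (hC : ∀ t, ∫ ω, D t ω ^ 2 ∂μ ≤ C)
    (h0 : ∀ g t, ∫ ω, weightedAvg α g (fun k => D k ω) t * D t ω ∂μ = 0) :
    AveragesTo μ α D 0 0 := by
  intro g δ hδ
  have hC0 : 0 ≤ C := (integral_nonneg fun ω => sq_nonneg _).trans (hC 0)
  have hsq : ∀ η > 0, ∀ᶠ t in atTop,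
      ∫ ω, weightedAvg α g (fun k => D k ω) t ^ 2 ∂μ ≤ 0 + η := by
    refine eventually_le_of_recursion (β := fun t => α t ^ 2 * C) hα.mem hα.sum_diverges
      (hα.summable_sq.mul_right C) (fun t => by positivity) fun t => ?_
    have ha := hα.mem t
    have h1 : ∫ ω, weightedAvg α g (fun k => D k ω) (t + 1) ^ 2 ∂μ =
        ∫ ω, ((1 - α t) ^ 2 * weightedAvg α g (fun k => D k ω) t ^ 2 +
          (2 * (1 - α t) * α t * (weightedAvg α g (fun k => D k ω) t * D t ω) +
            α t ^ 2 * D t ω ^ 2)) ∂μ := by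
      congr 1; ext ω; simp only [weightedAvg]; ring
    rw [h1, integral_add ((hH2 g t).const_mul _)
        (((hHD g t).const_mul _).fun_add ((hD2 t).const_mul _)),
      integral_add ((hHD g t).const_mul _) ((hD2 t).const_mul _), integral_const_mul,
      integral_const_mul, integral_const_mul, h0]
    have h2 : 0 ≤ ∫ ω, weightedAvg α g (fun k => D k ω) t ^ 2 ∂μ :=
      integral_nonneg fun ω => sq_nonneg _
    have h3 := mul_le_mul_of_nonneg_left (hC t) (sq_nonneg (α t))
    have h4 : (1 - α t) ^ 2 ≤ 1 - α t := by nlinarith [ha.1, ha.2]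
    have h5 := mul_le_mul_of_nonneg_right h4 h2
    linarith
  filter_upwards [hsq (δ ^ 2) (by positivity)] with t ht
  -- From `L²` to `L¹` by `a ≤ δ / 2 + a ^ 2 / (2 * δ)`, which is `(a - δ) ^ 2 ≥ 0`.
  have h1 : ∫ ω, |weightedAvg α g (fun k => D k ω) t - 0| ∂μ ≤
      ∫ ω, (δ / 2 + weightedAvg α g (fun k => D k ω) t ^ 2 * (2 * δ)⁻¹) ∂μ := by
    refine integral_mono_of_nonneg (ae_of_all _ fun ω => abs_nonneg _)
      ((integrable_const _).add ((hH2 g t).mul_const _)) (ae_of_all _ fun ω => ?_)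
    simp only [sub_zero]
    rw [← sq_abs]
    set a := |weightedAvg α g (fun k => D k ω) t|
    have h2 : δ / 2 + a ^ 2 * (2 * δ)⁻¹ - a = (a - δ) ^ 2 / (2 * δ) := by
      field_simp; ring
    have h3 : 0 ≤ (a - δ) ^ 2 / (2 * δ) := by positivity
    linarith
  rw [integral_add (integrable_const _) ((hH2 g t).mul_const _), integral_mul_const] at h1
  have h3 : (∫ ω, weightedAvg α g (fun k => D k ω) t ^ 2 ∂μ) * (2 * δ)⁻¹ ≤ δ / 2 := by
    calc _ ≤ δ ^ 2 * (2 * δ)⁻¹ := by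
          refine mul_le_mul_of_nonneg_right (by linarith) (by positivity)
      _ = δ / 2 := by field_simp
  simp only [integral_const, probReal_univ, one_smul] at h1
  linarith

end L1

/-! ### One-step conditional means of the behavior chain -/

namespace EmphaticModel

variable {S A : Type*} [Fintype S] [Fintype A] {n : ℕ}

/-- One-step transition probabilities of the behavior chain on state-action pairs. -/
def kernel (M : EmphaticModel S A n) (z z' : S × A) : ℝ :=
  M.trans z.1 z.2 z'.1 * M.behavior z'.1 z'.2

theorem kernel_nonneg (M : EmphaticModel S A n) (z z' : S × A) : 0 ≤ M.kernel z z' :=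
  mul_nonneg ((M.trans_mem z.1 z.2).1 _) ((M.behavior_mem z'.1).1 _)

theorem sum_kernel_mul (M : EmphaticModel S A n) (z : S × A) (u : S × A → ℝ) :
    ∑ z', M.kernel z z' * u z' =
      ∑ s', M.trans z.1 z.2 s' * ∑ a', M.behavior s' a' * u (s', a') := by
  rw [Fintype.sum_prod_type]
  refine Finset.sum_congr rfl fun s' _ => ?_
  rw [Finset.mul_sum]
  exact Finset.sum_congr rfl fun a' _ => by simp only [kernel]; ring

theorem sum_kernel (M : EmphaticModel S A n) (z : S × A) : ∑ z', M.kernel z z' = 1 := by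
  have := M.sum_kernel_mul z fun _ => 1
  simpa [(M.behavior_mem _).2, (M.trans_mem z.1 z.2).2] using this

/-- Mean of a path functional given the coordinates up to time `t`, when it depends only on the
coordinates up to time `t + 1`. -/
def stepMean (M : EmphaticModel S A n) (t : ℕ) (Φ : (ℕ → S × A) → ℝ) (z : ℕ → S × A) : ℝ :=
  ∑ z', M.kernel (z t) z' * Φ (Function.update z (t + 1) z')

theorem dependsOn_stepMean (M : EmphaticModel S A n) {t : ℕ} {Φ : (ℕ → S × A) → ℝ}
    (hΦ : DependsOn Φ (Set.Iic (t + 1))) : DependsOn (M.stepMean t Φ) (Set.Iic t) := by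
  intro z w hzw
  simp only [stepMean, hzw t (Set.mem_Iic.2 le_rfl)]
  refine Finset.sum_congr rfl fun z' _ => ?_
  congr 1
  refine hΦ fun k hk => ?_
  rcases eq_or_ne k (t + 1) with rfl | h
  · simp
  · rw [Function.update_of_ne h, Function.update_of_ne h]
    exact hzw k (Set.mem_Iic.2 (by have := Set.mem_Iic.1 hk; omega))

end EmphaticModel

namespace EmphaticModel.IsBehaviorChain

variable {S A : Type*} [Fintype S] [MeasurableSpace S] [MeasurableSingletonClass S]
  [Fintype A] [MeasurableSpace A] [MeasurableSingletonClass A] {n : ℕ}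
  {M : EmphaticModel S A n} {Ω : Type*} [MeasurableSpace Ω] {μ : Measure Ω}
  [IsProbabilityMeasure μ] {St : ℕ → Ω → S} {Ac : ℕ → Ω → A}

/-- At a fixed time only finitely many histories exist, so the functional takes finitely many
values. The map `e` extends a finite history by freezing its last entry. -/
theorem integrable_of_dependsOn {E : Type*} [NormedAddCommGroup E]
    (hc : M.IsBehaviorChain μ St Ac) {Φ : (ℕ → S × A) → E} {t : ℕ}
    (hΦ : DependsOn Φ (Set.Iic t)) :
    Integrable (fun ω => Φ fun k => (St k ω, Ac k ω)) μ := by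
  let R : Ω → Fin (t + 1) → S × A := fun ω k => (St k ω, Ac k ω)
  have hR : Measurable R := measurable_pi_lambda _ fun k =>
    (hc.measurable_state k).prodMk (hc.measurable_action k)
  let e : (Fin (t + 1) → S × A) → ℕ → S × A := fun w k => w (Fin.ofNat (t + 1) (min k t))
  have h1 : Integrable (fun w => Φ (e w)) (μ.map R) :=
    have := Measure.isProbabilityMeasure_map (μ := μ) hR.aemeasurable
    Integrable.of_finite
  refine (h1.comp_measurable hR).congr (ae_of_all _ fun ω => hΦ fun k hk => ?_)
  have hk' : k ≤ t := hk
  have : (k % (t + 1)) = k := Nat.mod_eq_of_lt (by omega)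
  simp [e, R, Fin.ofNat, min_eq_left hk', this]

/-- The tower property. Both integrands are finite sums over histories `w` up to time `t` and next
pairs `z'` of constants on cylinder events, and `transition` relates the probabilities of these
events. -/
theorem integral_eq_integral_stepMean (hc : M.IsBehaviorChain μ St Ac) {Φ : (ℕ → S × A) → ℝ}
    {t : ℕ} (hΦ : DependsOn Φ (Set.Iic (t + 1))) :
    ∫ ω, Φ (fun k => (St k ω, Ac k ω)) ∂μ =
      ∫ ω, M.stepMean t Φ (fun k => (St k ω, Ac k ω)) ∂μ := by
  classical
  let e : (Fin (t + 1) → S × A) → ℕ → S × A := fun w k => w (Fin.ofNat (t + 1) (min k t))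
  let B : ℕ → (ℕ → S × A) → Set Ω := fun r z => {ω | ∀ k ≤ r, St k ω = (z k).1 ∧ Ac k ω = (z k).2}
  have hB : ∀ r z, MeasurableSet (B r z) := fun r z => by
    have : B r z = ⋂ k, ⋂ (_ : k ≤ r), (St k ⁻¹' {(z k).1} ∩ Ac k ⁻¹' {(z k).2}) := by
      ext ω; simp [B]
    rw [this]
    exact MeasurableSet.iInter fun k => MeasurableSet.iInter fun _ =>
      (hc.measurable_state k (measurableSet_singleton _)).inter
        (hc.measurable_action k (measurableSet_singleton _))
  have he : ∀ (w : Fin (t + 1) → S × A) (z : ℕ → S × A),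
      (∀ k ≤ t, z k = e w k) ↔ w = fun k : Fin (t + 1) => z k := by
    intro w z
    have h1 : ∀ k ≤ t, ∀ hk : k < t + 1, e w k = w ⟨k, hk⟩ := fun k hk hk' => by
      simp [e, Fin.ofNat, min_eq_left hk, Nat.mod_eq_of_lt hk']
    constructor
    · intro h
      ext1 k
      rw [h k (by omega), h1 k (by omega) k.2]
    · rintro rfl k hk
      rw [h1 k hk (by omega)]
  have hmem : ∀ (w : Fin (t + 1) → S × A) (ω : Ω),
      ω ∈ B t (e w) ↔ w = fun k : Fin (t + 1) => (St k ω, Ac k ω) := by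
    intro w ω
    rw [← he w fun k => (St k ω, Ac k ω)]
    exact forall₂_congr fun k _ => by rw [Prod.ext_iff]
  have hmem' : ∀ (w : Fin (t + 1) → S × A) (z' : S × A) (ω : Ω),
      ω ∈ B (t + 1) (Function.update (e w) (t + 1) z') ↔
        (w = fun k : Fin (t + 1) => (St k ω, Ac k ω)) ∧ z' = (St (t + 1) ω, Ac (t + 1) ω) := by
    intro w z' ω
    rw [← hmem]
    constructor
    · intro h
      refine ⟨fun k hk => ?_, ?_⟩
      · have := h k (by omega)
        rwa [Function.update_of_ne (by omega)] at this
      · have := h (t + 1) le_rfl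
        rw [Function.update_self] at this
        exact Prod.ext this.1.symm this.2.symm
    · rintro ⟨h1, rfl⟩ k hk
      rcases eq_or_ne k (t + 1) with rfl | h
      · simp
      · rw [Function.update_of_ne h]
        exact h1 k (by omega)
  have hext : ∀ ω k, k ≤ t → e (fun k : Fin (t + 1) => (St k ω, Ac k ω)) k = (St k ω, Ac k ω) :=
    fun ω k hk => (((he _ fun k => (St k ω, Ac k ω)).2 rfl) k hk).symm
  have hL : ∀ ω, Φ (fun k => (St k ω, Ac k ω)) =
      ∑ w, ∑ z', (B (t + 1) (Function.update (e w) (t + 1) z')).indicator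
        (fun _ => Φ (Function.update (e w) (t + 1) z')) ω := by
    intro ω
    simp only [Set.indicator_apply, hmem', ite_and]
    rw [Finset.sum_eq_single (fun k : Fin (t + 1) => (St k ω, Ac k ω))]
    · simp only [if_true, Finset.sum_ite_eq', Finset.mem_univ]
      refine hΦ fun k hk => ?_
      rcases eq_or_ne k (t + 1) with rfl | h
      · simp
      · rw [Function.update_of_ne h, hext ω k (by have := Set.mem_Iic.1 hk; omega)]
    · intro w _ hw
      simp [hw]
    · simp
  have hR : ∀ ω, M.stepMean t Φ (fun k => (St k ω, Ac k ω)) =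
      ∑ w, ∑ z', (B t (e w)).indicator
        (fun _ => M.kernel (e w t) z' * Φ (Function.update (e w) (t + 1) z')) ω := by
    intro ω
    simp only [Set.indicator_apply, hmem]
    rw [Finset.sum_eq_single (fun k : Fin (t + 1) => (St k ω, Ac k ω))]
    · simp only [if_true]
      rw [← M.dependsOn_stepMean hΦ (x := e fun k : Fin (t + 1) => (St k ω, Ac k ω))
        fun k hk => hext ω k hk]
      rfl
    · intro w _ hw
      simp [hw]
    · simp
  have hi : ∀ (C : Set Ω), MeasurableSet C → ∀ c : ℝ, Integrable (C.indicator fun _ => c) μ :=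
    fun C hC c => (integrable_const c).indicator hC
  simp only [hL, hR]
  rw [integral_finsetSum _ fun w _ => integrable_finsetSum _ fun z' _ => hi _ (hB _ _) _,
    integral_finsetSum _ fun w _ => integrable_finsetSum _ fun z' _ => hi _ (hB _ _) _]
  refine Finset.sum_congr rfl fun w _ => ?_
  rw [integral_finsetSum _ fun z' _ => hi _ (hB _ _) _,
    integral_finsetSum _ fun z' _ => hi _ (hB _ _) _]
  refine Finset.sum_congr rfl fun z' _ => ?_
  rw [integral_indicator_const _ (hB _ _), integral_indicator_const _ (hB _ _)]
  have h1 := hc.transition t (fun k => (Function.update (e w) (t + 1) z' k).1)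
    (fun k => (Function.update (e w) (t + 1) z' k).2)
  have h2 : {ω | ∀ k ≤ t, St k ω = (Function.update (e w) (t + 1) z' k).1 ∧
      Ac k ω = (Function.update (e w) (t + 1) z' k).2} = B t (e w) := by
    ext ω
    refine forall₂_congr fun k hk => ?_
    rw [Function.update_of_ne (by omega)]
  rw [h2] at h1
  simp only [Function.update_self, Function.update_of_ne (show t ≠ t + 1 by omega)] at h1
  change μ.real (B (t + 1) _) = _ at h1
  rw [h1, smul_eq_mul, smul_eq_mul]
  simp only [kernel]
  ring

/-- The factor `Ψ` is known at time `t` and comes out of the conditional mean. -/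
theorem integral_mul_eq_zero (hc : M.IsBehaviorChain μ St Ac) {Ψ D : (ℕ → S × A) → ℝ} {t : ℕ}
    (hΨ : DependsOn Ψ (Set.Iic t)) (hD : DependsOn D (Set.Iic (t + 1)))
    (h0 : ∀ z, M.stepMean t D z = 0) :
    ∫ ω, Ψ (fun k => (St k ω, Ac k ω)) * D (fun k => (St k ω, Ac k ω)) ∂μ = 0 := by
  have hΨ' : DependsOn Ψ (Set.Iic (t + 1)) := hΨ.mono (Set.Iic_subset_Iic.2 (by omega))
  have h1 := hc.integral_eq_integral_stepMean (Φ := fun z => Ψ z * D z) (t := t)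
    fun z w hzw => by simp only [hΨ' hzw, hD hzw]
  rw [h1, ← integral_zero Ω ℝ (μ := μ)]
  refine integral_congr_ae (ae_of_all _ fun ω => ?_)
  set z : ℕ → S × A := fun k => (St k ω, Ac k ω)
  have h2 : M.stepMean t (fun z => Ψ z * D z) z = Ψ z * M.stepMean t D z := by
    simp only [stepMean]
    rw [Finset.mul_sum]
    refine Finset.sum_congr rfl fun z' _ => ?_
    rw [hΨ (y := z) fun k hk => Function.update_of_ne (by have := Set.mem_Iic.1 hk; omega) _ _]
    ring
  exact h2.trans (by rw [h0, mul_zero])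

end EmphaticModel.IsBehaviorChain

/-! ### Harmonic functions and the Poisson equation -/

namespace EmphaticModel

variable {S A : Type*} [Fintype S] [Fintype A] {n : ℕ}

theorem stepMean_sub (M : EmphaticModel S A n) (t : ℕ) (Φ Ψ : (ℕ → S × A) → ℝ) (z : ℕ → S × A) :
    M.stepMean t (fun w => Φ w - Ψ w) z = M.stepMean t Φ z - M.stepMean t Ψ z := by
  simp only [stepMean, mul_sub, Finset.sum_sub_distrib]

theorem stepMean_of_dependsOn (M : EmphaticModel S A n) {t : ℕ} {Φ : (ℕ → S × A) → ℝ}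
    (hΦ : DependsOn Φ (Set.Iic t)) (z : ℕ → S × A) : M.stepMean t Φ z = Φ z := by
  have h1 : ∀ z', Φ (Function.update z (t + 1) z') = Φ z := fun z' =>
    hΦ fun k hk => Function.update_of_ne (by have := Set.mem_Iic.1 hk; omega) _ _
  simp only [stepMean, h1, ← Finset.sum_mul, M.sum_kernel, one_mul]

theorem exists_bound_of_dependsOn {Z : Type*} [Finite Z] {g : (ℕ → Z) → ℝ} {K : ℕ}
    (hg : DependsOn g (Set.Iic K)) : ∃ C, ∀ z, |g z| ≤ C := by
  let e : (Fin (K + 1) → Z) → ℕ → Z := fun w k => w (Fin.ofNat (K + 1) (min k K))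
  obtain ⟨C, hC⟩ := (Set.finite_range fun w => |g (e w)|).bddAbove
  refine ⟨C, fun z => ?_⟩
  have h1 : g z = g (e fun k => z k) := hg fun k hk => by
    have hk' : k ≤ K := hk
    simp [e, Fin.ofNat, min_eq_left hk', Nat.mod_eq_of_lt (show k < K + 1 by omega)]
  rw [h1]
  exact hC ⟨fun k => z k, rfl⟩

variable [DecidableEq S]

/-- Harmonic functions of the behavior chain are constant. -/
theorem PolicyCondition.harmonic_eq {M : EmphaticModel S A n} (hM : M.PolicyCondition)
    {f : S × A → ℝ} (hf : ∀ z, f z = ∑ z', M.kernel z z' * f z') (z w : S × A) : f z = f w := by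
  set P := M.policyMatrix M.behavior with hP
  -- Irreducibility is assumed on states only, and some pairs may never be visited. The harmonic
  -- function is therefore expressed through its action average `v`, which is harmonic for `P`.
  set v : S → ℝ := fun s => ∑ a, M.behavior s a * f (s, a) with hv
  have hfv : ∀ z, f z = ∑ s', M.trans z.1 z.2 s' * v s' := fun z => by
    rw [hf z, M.sum_kernel_mul]
  have hPv : P.mulVec v = v := by
    ext s
    simp only [hP, policyMatrix, Matrix.mulVec, dotProduct, Matrix.of_apply]
    conv_rhs => simp only [hv]
    simp only [hfv, Finset.mul_sum, Finset.sum_mul]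
    rw [Finset.sum_comm]
    exact Finset.sum_congr rfl fun a _ => Finset.sum_congr rfl fun s' _ => by ring
  have hP1 : P.mulVec (fun _ => 1) = fun _ => 1 := by
    ext s
    simp only [hP, policyMatrix, Matrix.mulVec, dotProduct, Matrix.of_apply, mul_one]
    rw [Finset.sum_comm]
    simp [← Finset.mul_sum, (M.trans_mem _ _).2, (M.behavior_mem s).2]
  have hpow : ∀ u : S → ℝ, P.mulVec u = u → ∀ k, (P ^ k).mulVec u = u := fun u hu k => by
    induction k with
    | zero => simp
    | succ k ih => rw [pow_succ, ← Matrix.mulVec_mulVec, hu, ih]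
  have hnn : ∀ k i j, 0 ≤ (P ^ k) i j := fun k => by
    induction k with
    | zero => intro i j; simp only [pow_zero, Matrix.one_apply]; split_ifs <;> norm_num
    | succ k ih =>
      intro i j
      rw [pow_succ, Matrix.mul_apply]
      exact Finset.sum_nonneg fun l _ => mul_nonneg (ih i l) (hM.irreducible.nonneg l j)
  have : Nonempty S := ⟨z.1⟩
  -- Maximum principle: `v i` is a `P ^ k` average of values at most `v i`, so `v j = v i` whenever
  -- `(P ^ k) i j > 0`.
  obtain ⟨i, hi⟩ := Finite.exists_max v
  have hconst : ∀ j, v j = v i := by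
    intro j
    obtain ⟨k, -, hk⟩ :=
      (Matrix.isIrreducible_iff_exists_pow_pos hM.irreducible.nonneg).1 hM.irreducible i j
    have h1 := congrFun (hpow v hPv k) i
    have h2 := congrFun (hpow _ hP1 k) i
    simp only [Matrix.mulVec, dotProduct, mul_one] at h1 h2
    have h3 : ∑ l, (P ^ k) i l * (v i - v l) = 0 := by
      simp only [mul_sub, Finset.sum_sub_distrib, ← Finset.sum_mul, h1, h2, one_mul, sub_self]
    rw [Finset.sum_eq_zero_iff_of_nonneg fun l _ =>
      mul_nonneg (hnn k i l) (sub_nonneg.2 (hi l))] at h3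
    have h4 := h3 j (Finset.mem_univ j)
    rcases mul_eq_zero.1 h4 with h5 | h5
    · exact absurd h5 hk.ne'
    · linarith
  simp only [hfv, hconst, ← Finset.sum_mul, (M.trans_mem _ _).2]

/-- The Poisson equation of the behavior chain is solvable. -/
theorem PolicyCondition.exists_poisson {M : EmphaticModel S A n} (hM : M.PolicyCondition)
    (g : S × A → ℝ) :
    ∃ (c : ℝ) (f : S × A → ℝ), ∀ z, g z = c + (f z - ∑ z', M.kernel z z' * f z') := by
  rcases isEmpty_or_nonempty (S × A) with h | ⟨⟨z₀⟩⟩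
  · exact ⟨0, 0, fun z => (h.false z).elim⟩
  -- Adding the value at `z₀` to `f - Kf`, where `K` is the kernel operator, removes the kernel of
  -- constants. If `T f = 0` then `f - Kf` is the constant `-f z₀`; it is nonnegative at a maximum
  -- of `f` and nonpositive at a minimum, so `f` is harmonic with `f z₀ = 0`. Injectivity gives
  -- surjectivity in finite dimension.
  let T : (S × A → ℝ) →ₗ[ℝ] (S × A → ℝ) :=
    { toFun := fun f z => f z₀ + (f z - ∑ z', M.kernel z z' * f z')
      map_add' := fun f f' => by
        ext z; simp only [Pi.add_apply, mul_add, Finset.sum_add_distrib]; ring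
      map_smul' := fun r f => by
        ext z
        simp only [Pi.smul_apply, smul_eq_mul, RingHom.id_apply, mul_left_comm _ r,
          ← Finset.mul_sum]
        ring }
  have hT : Function.Injective T := by
    rw [injective_iff_map_eq_zero]
    intro f hf
    have h1 : ∀ z, f z₀ + (f z - ∑ z', M.kernel z z' * f z') = 0 := fun z => congrFun hf z
    have : Nonempty (S × A) := ⟨z₀⟩
    obtain ⟨x, hx⟩ := Finite.exists_max f
    obtain ⟨y, hy⟩ := Finite.exists_min f
    have h2 : ∑ z', M.kernel x z' * f z' ≤ f x := by
      calc _ ≤ ∑ z', M.kernel x z' * f x := Finset.sum_le_sum fun z' _ =>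
            mul_le_mul_of_nonneg_left (hx z') (M.kernel_nonneg _ _)
        _ = f x := by rw [← Finset.sum_mul, M.sum_kernel, one_mul]
    have h3 : f y ≤ ∑ z', M.kernel y z' * f z' := by
      calc f y = ∑ z', M.kernel y z' * f y := by rw [← Finset.sum_mul, M.sum_kernel, one_mul]
        _ ≤ _ := Finset.sum_le_sum fun z' _ =>
            mul_le_mul_of_nonneg_left (hy z') (M.kernel_nonneg _ _)
    have h4 : f z₀ = 0 := by linarith [h1 x, h1 y]
    ext z
    rw [hM.harmonic_eq (f := f) (fun z => by linarith [h1 z]) z z₀, h4, Pi.zero_apply]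
  obtain ⟨f, hf⟩ := LinearMap.injective_iff_surjective.1 hT g
  exact ⟨f z₀, f, fun z => (congrFun hf z).symm⟩

end EmphaticModel

/-! ### Law of large numbers for window functions -/

namespace EmphaticModel.IsBehaviorChain

variable {S A : Type*} [Fintype S] [MeasurableSpace S] [MeasurableSingletonClass S]
  [Fintype A] [MeasurableSpace A] [MeasurableSingletonClass A] {n : ℕ}
  {M : EmphaticModel S A n} {Ω : Type*} [MeasurableSpace Ω] {μ : Measure Ω}
  [IsProbabilityMeasure μ] {St : ℕ → Ω → S} {Ac : ℕ → Ω → A}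

theorem integrable_shift {E : Type*} [NormedAddCommGroup E]
    (hc : M.IsBehaviorChain μ St Ac) {g : (ℕ → S × A) → E} {K : ℕ}
    (hg : DependsOn g (Set.Iic K)) (t : ℕ) :
    Integrable (fun ω => g fun k => (St (t + k) ω, Ac (t + k) ω)) μ :=
  hc.integrable_of_dependsOn (Φ := fun z => g fun k => z (t + k)) (t := t + K)
    fun _ _ h => hg fun k hk => h (t + k) (Set.mem_Iic.2 (Nat.add_le_add_left hk t))

theorem averagesTo_martingale_difference (hc : M.IsBehaviorChain μ St Ac) {α : ℕ → ℝ}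
    (hα : StepsizeCondition α) {D : (ℕ → S × A) → ℝ} {K : ℕ}
    (hD : DependsOn D (Set.Iic (K + 1))) (h0 : ∀ z, M.stepMean K D z = 0) :
    AveragesTo μ α (fun t ω => D fun k => (St (t + k) ω, Ac (t + k) ω)) 0 0 := by
  obtain ⟨C, hC⟩ := exists_bound_of_dependsOn hD
  -- The window is reindexed to end at time `t + 1`, so that earlier terms are functions of the
  -- coordinates up to `t`. It is set to zero while a full window is not yet available, and the
  -- delay `K` is undone by a shift at the end.
  let E : ℕ → (ℕ → S × A) → ℝ := fun t z => if t < K then 0 else D fun k => z (t - K + k)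
  have hE : ∀ t, DependsOn (E t) (Set.Iic (t + 1)) := by
    intro t z w h
    simp only [E]
    split_ifs with ht
    · rfl
    · exact hD fun k hk => h _ (by have := Set.mem_Iic.1 hk; exact Set.mem_Iic.2 (by omega))
  have hE0 : ∀ t z, M.stepMean t (E t) z = 0 := by
    intro t z
    rcases lt_or_ge t K with ht | ht
    · simp [stepMean, E, ht]
    · rw [← h0 fun k => z (t - K + k)]
      simp only [stepMean, E, not_lt.2 ht, if_false, Nat.sub_add_cancel ht]
      refine Finset.sum_congr rfl fun z' _ => ?_
      congr 2
      ext1 k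
      simp only [Function.update_apply]
      have : t - K + k = t + 1 ↔ k = K + 1 := by omega
      simp only [this]
  have hEC : ∀ t z, |E t z| ≤ C := by
    intro t z
    simp only [E]
    split_ifs
    · simpa using (abs_nonneg _).trans (hC z)
    · exact hC _
  have hH : ∀ g t, DependsOn (fun z => weightedAvg α g (fun k => E k z) t) (Set.Iic t) := by
    intro g t z w h
    exact weightedAvg_congr fun k hk => hE k fun j hj =>
      h j (by have := Set.mem_Iic.1 hj; exact Set.mem_Iic.2 (by omega))
  have hEint : ∀ t, Integrable (fun ω => E t fun k => (St k ω, Ac k ω)) μ :=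
    fun t => hc.integrable_of_dependsOn (hE t)
  have hE2 : ∀ t, Integrable (fun ω => (E t fun k => (St k ω, Ac k ω)) ^ 2) μ := fun t =>
    hc.integrable_of_dependsOn (Φ := fun z => E t z ^ 2) (t := t + 1)
      fun z w h => by simp only [hE t h]
  have key : AveragesTo μ α (fun t ω => E t fun k => (St k ω, Ac k ω)) 0 0 := by
    refine averagesTo_of_orthogonal hα (C := C ^ 2) hE2 ?_ ?_ ?_ ?_
    · exact fun g t => hc.integrable_of_dependsOn
        (Φ := fun z => weightedAvg α g (fun k => E k z) t ^ 2) (t := t)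
        fun z w h => congrArg (· ^ 2) (hH g t h)
    · exact fun g t => hc.integrable_of_dependsOn
        (Φ := fun z => weightedAvg α g (fun k => E k z) t * E t z) (t := t + 1)
        fun z w h => congrArg₂ (· * ·)
          ((hH g t).mono (Set.Iic_subset_Iic.2 (Nat.le_succ t)) h) (hE t h)
    · intro t
      calc _ ≤ ∫ _, C ^ 2 ∂μ := integral_mono (hE2 t) (integrable_const _) fun ω => by
            rw [← sq_abs]
            exact pow_le_pow_left₀ (abs_nonneg _) (hEC t fun k => (St k ω, Ac k ω)) 2
        _ = C ^ 2 := by simp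
    · exact fun g t => hc.integral_mul_eq_zero (hH g t) (hE t) (hE0 t)
  have h1 := key.add_nat hα (C := C) hEint (fun t => ?_) K
  · refine h1.congr_fun fun t ω => ?_
    simp [E]
  · calc _ ≤ ∫ _, C ∂μ := integral_mono (hEint t).abs (integrable_const _) fun ω =>
          hEC t fun k => (St k ω, Ac k ω)
      _ = C := by simp

end EmphaticModel.IsBehaviorChain

namespace EmphaticModel

variable {S A : Type*} [Fintype S] [DecidableEq S] [MeasurableSpace S] [MeasurableSingletonClass S]
  [Fintype A] [MeasurableSpace A] [MeasurableSingletonClass A] {n : ℕ}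

/-- Law of large numbers for functions of finitely many consecutive state-action pairs. -/
theorem PolicyCondition.exists_averagesTo_window {M : EmphaticModel S A n}
    (hM : M.PolicyCondition) (K : ℕ) (g : (ℕ → S × A) → ℝ) (hg : DependsOn g (Set.Iic K)) :
    ∃ c, ∀ α : ℕ → ℝ, StepsizeCondition α →
      ∀ (Ω : Type*) [MeasurableSpace Ω] (μ : Measure Ω) [IsProbabilityMeasure μ]
        (St : ℕ → Ω → S) (Ac : ℕ → Ω → A), M.IsBehaviorChain μ St Ac →
      AveragesTo μ α (fun t ω => g fun k => (St (t + k) ω, Ac (t + k) ω)) c 0 := by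
  induction K generalizing g with
  | zero =>
    -- The Poisson equation splits the input into `c`, the forward difference of `-f`, and the
    -- martingale difference `D`.
    obtain ⟨c, f, hf⟩ := hM.exists_poisson fun x => g fun _ => x
    refine ⟨c, fun α hα Ω _ μ _ St Ac hc => ?_⟩
    let F : (ℕ → S × A) → ℝ := fun z => f (z 0)
    have hF : DependsOn F (Set.Iic 0) := fun z w h => congrArg f (h 0 (Set.mem_Iic.2 le_rfl))
    let D : (ℕ → S × A) → ℝ := fun z => f (z 1) - ∑ z', M.kernel (z 0) z' * f z'
    have hD : DependsOn D (Set.Iic (0 + 1)) := fun z w h => by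
      simp only [D, h 0 (Set.mem_Iic.2 (by omega)), h 1 (Set.mem_Iic.2 (by omega))]
    have hD0 : ∀ z, M.stepMean 0 D z = 0 := fun z => by
      simp only [stepMean, D, zero_add, Function.update_self,
        Function.update_of_ne (show (0 : ℕ) ≠ 1 by omega), mul_sub, Finset.sum_sub_distrib]
      rw [← Finset.sum_mul, M.sum_kernel, one_mul, sub_self]
    obtain ⟨C, hC⟩ := exists_bound_of_dependsOn hF
    have iF := hc.integrable_shift hF
    have h1 : AveragesTo μ α (fun _ _ => c) c 0 :=
      averagesTo_of_integral_abs_sub_le hα (fun _ => integrable_const c) (by simp)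
    have h2 := averagesTo_forward_sub hα (C := C) (fun t => (iF t).neg) fun t => by
      calc _ ≤ ∫ _, C ∂μ := integral_mono (iF t).neg.abs (integrable_const _) fun ω => by
            simpa using hC fun k => (St (t + k) ω, Ac (t + k) ω)
        _ = C := by simp
    have h3 := hc.averagesTo_martingale_difference hα hD hD0
    have h4 := (h1.add (fun _ => integrable_const c)
      (fun t => ((iF (t + 1)).neg.sub (iF t).neg)) h2).add
      (fun t => (integrable_const c).add ((iF (t + 1)).neg.sub (iF t).neg))
      (hc.integrable_shift hD) h3
    simp only [add_zero] at h4
    refine h4.congr_fun fun t ω => ?_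
    have h5 := hf (St t ω, Ac t ω)
    have h6 : (g fun k => (St (t + k) ω, Ac (t + k) ω)) = g fun _ => (St t ω, Ac t ω) :=
      hg fun k hk => by rw [Nat.le_zero.1 hk]; rfl
    rw [h6, h5]
    simp only [F, D, Pi.add_apply, Pi.sub_apply, Pi.neg_apply, add_zero]
    ring
  | succ K ih =>
    -- Replacing `g` by its conditional mean costs a martingale difference and shortens the window
    -- by one.
    have hg' := M.dependsOn_stepMean hg
    obtain ⟨c, hc'⟩ := ih (M.stepMean K g) hg'
    refine ⟨c, fun α hα Ω _ μ _ St Ac hc => ?_⟩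
    have hD : DependsOn (fun z => g z - M.stepMean K g z) (Set.Iic (K + 1)) := fun z w h => by
      simp only [hg h, hg'.mono (Set.Iic_subset_Iic.2 (Nat.le_succ K)) h]
    have h3 := hc.averagesTo_martingale_difference hα hD fun z => by
      rw [stepMean_sub, M.stepMean_of_dependsOn hg', sub_self]
    have h4 := (hc' α hα Ω μ St Ac hc).add (hc.integrable_shift hg')
      (hc.integrable_shift hD) h3
    simpa using h4

end EmphaticModel

/-! ### Lyapunov function and contraction of the trace recursion -/

namespace EmphaticModel

variable {S A : Type*} [Fintype S] [Fintype A] {n : ℕ}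

theorem ratio_nonneg (M : EmphaticModel S A n) (s : S) (a : A) : 0 ≤ M.ratio s a :=
  div_nonneg ((M.target_mem s).1 a) ((M.behavior_mem s).1 a)

/-- The solution of `V = 1 + P_π Γ V` is at least one. -/
theorem PolicyCondition.exists_value [DecidableEq S] {M : EmphaticModel S A n}
    (hM : M.PolicyCondition) :
    ∃ V : S → ℝ, (∀ s, 1 ≤ V s) ∧
      ∀ s, V s = 1 + ∑ s', M.policyMatrix M.target s s' * M.gam s' * V s' := by
  set Q := M.policyMatrix M.target * Matrix.diagonal M.gam with hQ
  have hQe : ∀ s s', Q s s' = M.policyMatrix M.target s s' * M.gam s' := fun s s' => by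
    rw [hQ, Matrix.mul_diagonal]
  have hP0 : ∀ s s', 0 ≤ M.policyMatrix M.target s s' := fun s s' =>
    Finset.sum_nonneg fun a _ => mul_nonneg ((M.target_mem s).1 a) ((M.trans_mem s a).1 s')
  have hP1 : ∀ s, ∑ s', M.policyMatrix M.target s s' = 1 := fun s => by
    simp only [policyMatrix, Matrix.of_apply]
    rw [Finset.sum_comm]
    simp [← Finset.mul_sum, (M.trans_mem _ _).2, (M.target_mem s).2]
  have hQ0 : ∀ s s', 0 ≤ Q s s' := fun s s' => by
    rw [hQe]; exact mul_nonneg (hP0 s s') (M.gam_mem s').1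
  have hmono : ∀ u v : S → ℝ, (∀ s, u s ≤ v s) → ∀ s, Q.mulVec u s ≤ Q.mulVec v s :=
    fun u v h s => Finset.sum_le_sum fun s' _ => mul_le_mul_of_nonneg_left (h s') (hQ0 s s')
  have hQ1 : ∀ s, Q.mulVec (fun _ => 1) s ≤ 1 := fun s => by
    simp only [Matrix.mulVec, dotProduct, mul_one, hQe]
    rw [← hP1 s]
    refine Finset.sum_le_sum fun s' _ => ?_
    exact mul_le_of_le_one_right (hP0 s s') (M.gam_mem s').2
  -- Since `Q` is substochastic, `Q ^ k 1` decreases to a fixed vector of `Q`, which is zero by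
  -- invertibility of `1 - Q`. No bound on the spectral radius is needed.
  let u : ℕ → S → ℝ := fun k => Q.mulVec^[k] fun _ => 1
  have hu : ∀ k, u (k + 1) = Q.mulVec (u k) := fun k => Function.iterate_succ_apply' _ _ _
  have hu0 : ∀ k s, 0 ≤ u k s := fun k => by
    induction k with
    | zero => intro s; exact zero_le_one
    | succ k ih =>
      intro s
      rw [hu]
      exact Finset.sum_nonneg fun s' _ => mul_nonneg (hQ0 s s') (ih s')
  have hanti : ∀ k s, u (k + 1) s ≤ u k s := fun k => by
    induction k with
    | zero => intro s; exact hQ1 s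
    | succ k ih => intro s; rw [hu (k + 1), hu k]; rw [hu k] at ih; exact hmono _ _ ih s
  have hconv : ∀ s, ∃ v, Tendsto (fun k => u k s) atTop (𝓝 v) := fun s =>
    ⟨_, tendsto_atTop_ciInf (antitone_nat_of_succ_le fun k => hanti k s)
      ⟨0, by rintro _ ⟨k, rfl⟩; exact hu0 k s⟩⟩
  choose v hv using hconv
  have hQv : Q.mulVec v = v := by
    ext s
    refine tendsto_nhds_unique (f := fun k => u (k + 1) s) ?_
      ((tendsto_add_atTop_iff_nat 1).2 (hv s))
    simp only [hu]
    exact tendsto_finsetSum _ fun s' _ => (hv s').const_mul _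
  have hinv := hM.isUnit
  rw [← hQ] at hinv
  have hdet := (Matrix.isUnit_iff_isUnit_det _).1 hinv
  have hv0 : v = 0 := by
    have h1 : (1 - Q).mulVec v = 0 := by rw [Matrix.sub_mulVec, Matrix.one_mulVec, hQv, sub_self]
    have h2 := congrArg (1 - Q)⁻¹.mulVec h1
    rwa [Matrix.mulVec_mulVec, Matrix.nonsing_inv_mul _ hdet, Matrix.one_mulVec,
      Matrix.mulVec_zero] at h2
  let V : S → ℝ := (1 - Q)⁻¹.mulVec fun _ => 1
  have hV : ∀ s, V s = 1 + Q.mulVec V s := by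
    intro s
    have h1 : (1 - Q).mulVec V = fun _ => 1 := by
      simp only [V]
      rw [Matrix.mulVec_mulVec, Matrix.mul_nonsing_inv _ hdet, Matrix.one_mulVec]
    rw [Matrix.sub_mulVec, Matrix.one_mulVec] at h1
    have := congrFun h1 s
    simp only [Pi.sub_apply] at this
    linarith
  obtain ⟨C, hC⟩ := (Set.finite_range fun s => -V s).bddAbove
  -- The bound `V ≥ -C` is improved by iterating `V ≥ Q V`; in the limit it gives `V ≥ 0`.
  have hlow : ∀ k s, -C * u k s ≤ V s := fun k => by
    induction k with
    | zero =>
      intro s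
      have : -V s ≤ C := hC ⟨s, rfl⟩
      simp only [u, Function.iterate_zero, id]
      linarith
    | succ k ih =>
      intro s
      have h1 := hmono (fun s => -C * u k s) V ih s
      have h2 : Q.mulVec (fun s => -C * u k s) s = -C * u (k + 1) s := by
        rw [hu]
        exact congrFun (Matrix.mulVec_smul Q (-C) (u k)) s
      rw [h2] at h1
      linarith [hV s]
  have hV0 : ∀ s, 0 ≤ V s := fun s => by
    have h1 := (hv s).const_mul (-C)
    rw [hv0, Pi.zero_apply, mul_zero] at h1
    exact le_of_tendsto' h1 fun k => hlow k s
  refine ⟨V, fun s => ?_, fun s => ?_⟩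
  · have : 0 ≤ Q.mulVec V s := Finset.sum_nonneg fun s' _ => mul_nonneg (hQ0 s s') (hV0 s')
    linarith [hV s]
  · simpa only [Matrix.mulVec, dotProduct, hQe] using hV s

/-- A Lyapunov function for the products of the factors `γ ρ` along the behavior chain. -/
theorem PolicyCondition.exists_lyapunov [DecidableEq S] {M : EmphaticModel S A n}
    (hM : M.PolicyCondition) :
    ∃ (U : S × A → ℝ) (β : ℝ), 0 ≤ β ∧ β < 1 ∧ (∀ z, 0 ≤ U z) ∧
      (∀ z, ∑ z', M.kernel z z' * (M.gam z'.1 * M.ratio z.1 z.2 * U z') ≤ β * U z) ∧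
      ∀ z, ∑ z', M.kernel z z' * (M.gam z'.1 * M.ratio z.1 z.2 * 1) ≤ 1 * U z := by
  obtain ⟨V, hV1, hV⟩ := hM.exists_value
  obtain ⟨B, hB⟩ := (Set.finite_range V).bddAbove
  have hBV : ∀ s, V s ≤ max B 1 := fun s => (hB ⟨s, rfl⟩).trans (le_max_left _ _)
  have hB1 : 0 < max B 1 := lt_of_lt_of_le one_pos (le_max_right _ _)
  set b := max B 1 with hb
  -- Here `Q V = V - 1`, and `1 ≥ V / b` since `b` bounds `V`.
  have hQV : ∀ s, ∑ s', M.policyMatrix M.target s s' * M.gam s' * V s' ≤ (1 - b⁻¹) * V s := by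
    intro s
    have h1 : b⁻¹ * V s ≤ 1 := by
      rw [inv_mul_le_iff₀ hB1, mul_one]; exact hBV s
    linarith [hV s]
  have hcov : ∀ s a, M.behavior s a * M.ratio s a = M.target s a := by
    intro s a
    rcases ((M.target_mem s).1 a).eq_or_lt with h | h
    · simp [ratio, ← h]
    · rw [ratio, mul_div_cancel₀ _ (hM.coverage s a h).ne']
  let W : S × A → ℝ := fun z => ∑ s', M.trans z.1 z.2 s' * (M.gam s' * V s')
  have hW0 : ∀ z, 0 ≤ W z := fun z => Finset.sum_nonneg fun s' _ =>
    mul_nonneg ((M.trans_mem _ _).1 s')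
      (mul_nonneg (M.gam_mem s').1 (zero_le_one.trans (hV1 s')))
  -- The ratio in `U` turns the behavior average over the next action into a target average, to
  -- which `hQV` applies. The last bound, from `V ≥ 1`, later exchanges the weight `U` for the
  -- weight one.
  refine ⟨fun z => M.ratio z.1 z.2 * W z, 1 - b⁻¹, ?_, ?_, ?_, ?_, ?_⟩
  · exact sub_nonneg.2 (inv_le_one_of_one_le₀ (le_max_right _ _))
  · linarith [inv_pos.2 hB1]
  · exact fun z => mul_nonneg (M.ratio_nonneg _ _) (hW0 z)
  · intro z
    rw [M.sum_kernel_mul z fun z' => M.gam z'.1 * M.ratio z.1 z.2 * (M.ratio z'.1 z'.2 * W z')]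
    have h1 : ∀ s', ∑ a', M.behavior s' a' *
        (M.gam s' * M.ratio z.1 z.2 * (M.ratio s' a' * W (s', a'))) =
        M.gam s' * M.ratio z.1 z.2 *
          ∑ s'', M.policyMatrix M.target s' s'' * M.gam s'' * V s'' := by
      intro s'
      simp only [W, policyMatrix, Matrix.of_apply, Finset.sum_mul]
      rw [Finset.sum_comm, Finset.mul_sum]
      refine Finset.sum_congr rfl fun a' _ => ?_
      rw [← hcov, Finset.mul_sum, Finset.mul_sum, Finset.mul_sum, Finset.mul_sum]
      exact Finset.sum_congr rfl fun s'' _ => by ring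
    simp only [h1]
    rw [← mul_assoc, mul_comm (1 - b⁻¹), mul_assoc]
    simp only [W, Finset.mul_sum (a := 1 - b⁻¹)]
    rw [Finset.mul_sum]
    refine Finset.sum_le_sum fun s' _ => ?_
    calc _ ≤ M.trans z.1 z.2 s' * (M.gam s' * M.ratio z.1 z.2 * ((1 - b⁻¹) * V s')) :=
          mul_le_mul_of_nonneg_left (mul_le_mul_of_nonneg_left (hQV s')
            (mul_nonneg (M.gam_mem s').1 (M.ratio_nonneg _ _))) ((M.trans_mem _ _).1 s')
      _ = _ := by ring
  · intro z
    rw [M.sum_kernel_mul z fun z' => M.gam z'.1 * M.ratio z.1 z.2 * 1, one_mul]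
    simp only [W]
    rw [Finset.mul_sum]
    refine Finset.sum_le_sum fun s' _ => ?_
    rw [← Finset.sum_mul, (M.behavior_mem s').2, one_mul, mul_one]
    calc _ ≤ M.trans z.1 z.2 s' * (M.gam s' * M.ratio z.1 z.2 * V s') :=
          mul_le_mul_of_nonneg_left (le_mul_of_one_le_right
            (mul_nonneg (M.gam_mem s').1 (M.ratio_nonneg _ _)) (hV1 s')) ((M.trans_mem _ _).1 s')
      _ = _ := by ring

/-- One step of the trace recursion, from the pair `z` to the state `s'`. -/
noncomputable def traceStep (M : EmphaticModel S A n) (z : S × A) (s' : S) (y : TraceSpace n) :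
    TraceSpace n :=
  let F := M.gam s' * M.ratio z.1 z.2 * y.2 + M.interest s'
  ((M.lam s' * M.gam s' * M.ratio z.1 z.2) • y.1 +
    (M.lam s' * M.interest s' + (1 - M.lam s') * F) • M.feature s', F)

/-- The traces along a path of state-action pairs. -/
noncomputable def pathTraces (M : EmphaticModel S A n) (y : TraceSpace n) (z : ℕ → S × A)
    (t : ℕ) : TraceSpace n :=
  M.traces y (fun k => (z k).1) (fun k => (z k).2) t

theorem pathTraces_zero (M : EmphaticModel S A n) (y : TraceSpace n) (z : ℕ → S × A) :
    M.pathTraces y z 0 = y := rfl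

theorem pathTraces_succ (M : EmphaticModel S A n) (y : TraceSpace n) (z : ℕ → S × A) (t : ℕ) :
    M.pathTraces y z (t + 1) = M.traceStep (z t) (z (t + 1)).1 (M.pathTraces y z t) := rfl

theorem dependsOn_pathTraces (M : EmphaticModel S A n) (y : TraceSpace n) (t : ℕ) :
    DependsOn (fun z => M.pathTraces y z t) (Set.Iic t) := by
  induction t with
  | zero => intro z w _; rfl
  | succ t ih =>
    intro z w h
    simp only [pathTraces_succ]
    have h1 : M.pathTraces y z t = M.pathTraces y w t :=
      ih.mono (Set.Iic_subset_Iic.2 (Nat.le_succ t)) h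
    rw [h1, h t (Set.mem_Iic.2 (Nat.le_succ t)),
      h (t + 1) (Set.mem_Iic.2 le_rfl)]

/-- A real function of the traces and of a transition, along a path. -/
noncomputable def pathInput (M : EmphaticModel S A n) (h : TraceSpace n → S → A → S → ℝ)
    (y : TraceSpace n) (t : ℕ) (z : ℕ → S × A) : ℝ :=
  h (M.pathTraces y z t) (z t).1 (z t).2 (z (t + 1)).1

theorem dependsOn_pathInput (M : EmphaticModel S A n) (h : TraceSpace n → S → A → S → ℝ)
    (y : TraceSpace n) (t : ℕ) : DependsOn (M.pathInput h y t) (Set.Iic (t + 1)) := by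
  intro z w hzw
  have h1 : M.pathTraces y z t = M.pathTraces y w t :=
    (M.dependsOn_pathTraces y t).mono (Set.Iic_subset_Iic.2 (Nat.le_succ t)) hzw
  simp only [pathInput, h1, hzw t (Set.mem_Iic.2 (Nat.le_succ t)),
    hzw (t + 1) (Set.mem_Iic.2 le_rfl)]

/-- A norm on the traces that gives weight `κ` to the follow-on trace. -/
def weightedNorm (κ : ℝ) (y : TraceSpace n) : ℝ := ‖y.1‖ + κ * |y.2|

theorem weightedNorm_nonneg {κ : ℝ} (hκ : 0 ≤ κ) (y : TraceSpace n) : 0 ≤ weightedNorm κ y :=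
  add_nonneg (norm_nonneg _) (mul_nonneg hκ (abs_nonneg _))

theorem weightedNorm_add_le {κ : ℝ} (hκ : 0 ≤ κ) (y y' : TraceSpace n) :
    weightedNorm κ (y + y') ≤ weightedNorm κ y + weightedNorm κ y' := by
  have h1 := norm_add_le y.1 y'.1
  have h2 := mul_le_mul_of_nonneg_left (abs_add_le y.2 y'.2) hκ
  simp only [weightedNorm, Prod.fst_add, Prod.snd_add]
  linarith

theorem norm_le_weightedNorm {κ : ℝ} (hκ : 1 ≤ κ) (y : TraceSpace n) : ‖y‖ ≤ weightedNorm κ y := by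
  have h1 := norm_nonneg y.1
  have h2 := abs_nonneg y.2
  have h3 := mul_le_mul_of_nonneg_right hκ h2
  refine max_le ?_ ?_
  · exact le_add_of_nonneg_right (by linarith)
  · rw [Real.norm_eq_abs]; simp only [weightedNorm]; linarith

/-- The step is affine, so the interest terms cancel. The follow-on trace feeds into the eligibility
trace with a coefficient of norm at most `C * γ ρ`; a large weight `κ` absorbs this at the price of
a factor `b` that may be chosen close to one. -/
theorem weightedNorm_traceStep_sub_le (M : EmphaticModel S A n) {κ b C : ℝ} (hb : 1 ≤ b)
    (hC : ∀ s, ‖M.feature s‖ ≤ C) (hκ : C ≤ (b - 1) * κ) (z : S × A) (s' : S)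
    (y y' : TraceSpace n) :
    weightedNorm κ (M.traceStep z s' y - M.traceStep z s' y') ≤
      b * (M.gam s' * M.ratio z.1 z.2) * weightedNorm κ (y - y') := by
  set r := M.gam s' * M.ratio z.1 z.2 with hr
  have hr0 : 0 ≤ r := mul_nonneg (M.gam_mem s').1 (M.ratio_nonneg _ _)
  obtain ⟨hl0, hl1⟩ := M.lam_mem s'
  have h1 : (M.traceStep z s' y - M.traceStep z s' y').2 = r * (y - y').2 := by
    simp only [traceStep, Prod.snd_sub]; ring
  have h2 : (M.traceStep z s' y - M.traceStep z s' y').1 =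
      (M.lam s' * r) • (y - y').1 + ((1 - M.lam s') * (r * (y - y').2)) • M.feature s' := by
    simp only [traceStep, Prod.fst_sub, Prod.snd_sub]
    ext i
    simp only [Pi.sub_apply, Pi.add_apply, Pi.smul_apply, smul_eq_mul]
    ring
  have h3 : ‖(M.traceStep z s' y - M.traceStep z s' y').1‖ ≤
      r * ‖(y - y').1‖ + r * |(y - y').2| * C := by
    rw [h2]
    refine (norm_add_le _ _).trans (add_le_add ?_ ?_)
    · rw [norm_smul, Real.norm_of_nonneg (mul_nonneg hl0 hr0)]
      exact mul_le_mul_of_nonneg_right (mul_le_of_le_one_left hr0 hl1) (norm_nonneg _)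
    · rw [norm_smul, norm_mul, norm_mul, Real.norm_of_nonneg (sub_nonneg.2 hl1),
        Real.norm_of_nonneg hr0, Real.norm_eq_abs]
      have h4 : 0 ≤ r * |(y - y').2| := mul_nonneg hr0 (abs_nonneg _)
      exact mul_le_mul (mul_le_of_le_one_left h4 (by linarith)) (hC s') (norm_nonneg _) h4
  have h5 : |(M.traceStep z s' y - M.traceStep z s' y').2| = r * |(y - y').2| := by
    rw [h1, abs_mul, abs_of_nonneg hr0]
  unfold weightedNorm
  rw [h5]
  have h6 := mul_le_mul_of_nonneg_left hκ (mul_nonneg hr0 (abs_nonneg (y - y').2))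
  have h7 := mul_le_mul_of_nonneg_right hb (mul_nonneg hr0 (norm_nonneg (y - y').1))
  linarith

end EmphaticModel

/-! ### First moments of the traces and forgetting of the start -/

namespace EmphaticModel.IsBehaviorChain

variable {S A : Type*} [Fintype S] [MeasurableSpace S] [MeasurableSingletonClass S]
  [Fintype A] [MeasurableSpace A] [MeasurableSingletonClass A] {n : ℕ}
  {M : EmphaticModel S A n} {Ω : Type*} [MeasurableSpace Ω] {μ : Measure Ω}
  [IsProbabilityMeasure μ] {St : ℕ → Ω → S} {Ac : ℕ → Ω → A}

/-- Conditioning on time `t` moves the factor `γ ρ` onto the weight, where the kernel bound applies.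
With `W = U` this is the contraction; with `W = 1` it removes the weight. -/
theorem integral_le_of_kernel_le (hc : M.IsBehaviorChain μ St Ac) {X X' : (ℕ → S × A) → ℝ}
    {t : ℕ} {U W : S × A → ℝ} {b c θ C : ℝ} (hb : 0 ≤ b) (hc0 : 0 ≤ c)
    (hX : DependsOn X (Set.Iic t)) (hX' : DependsOn X' (Set.Iic (t + 1))) (hX0 : ∀ z, 0 ≤ X z)
    (hW : ∀ z, 0 ≤ W z) (hWC : ∀ z, W z ≤ C)
    (hUW : ∀ z, ∑ z', M.kernel z z' * (M.gam z'.1 * M.ratio z.1 z.2 * W z') ≤ θ * U z)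
    (hXX' : ∀ z, X' z ≤ b * (M.gam (z (t + 1)).1 * M.ratio (z t).1 (z t).2) * X z + c) :
    ∫ ω, X' (fun k => (St k ω, Ac k ω)) * W (St (t + 1) ω, Ac (t + 1) ω) ∂μ ≤
      b * θ * ∫ ω, X (fun k => (St k ω, Ac k ω)) * U (St t ω, Ac t ω) ∂μ + c * C := by
  let Φ : (ℕ → S × A) → ℝ := fun z =>
    X z * (M.gam (z (t + 1)).1 * M.ratio (z t).1 (z t).2 * W (z (t + 1)))
  have hle : Set.Iic t ⊆ Set.Iic (t + 1) := Set.Iic_subset_Iic.2 (Nat.le_succ t)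
  have hΦ : DependsOn Φ (Set.Iic (t + 1)) := fun z w h => by
    simp only [Φ, hX.mono hle h, h t (Set.mem_Iic.2 (Nat.le_succ t)),
      h (t + 1) (Set.mem_Iic.2 le_rfl)]
  have iΦ := hc.integrable_of_dependsOn hΦ
  have iX' : Integrable (fun ω => X' (fun k => (St k ω, Ac k ω)) *
      W (St (t + 1) ω, Ac (t + 1) ω)) μ :=
    hc.integrable_of_dependsOn (Φ := fun z => X' z * W (z (t + 1))) (t := t + 1)
      fun z w h => by simp only [hX' h, h (t + 1) (Set.mem_Iic.2 le_rfl)]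
  have iX : Integrable (fun ω => X (fun k => (St k ω, Ac k ω)) * U (St t ω, Ac t ω)) μ :=
    hc.integrable_of_dependsOn (Φ := fun z => X z * U (z t)) (t := t)
      fun z w h => by simp only [hX h, h t (Set.mem_Iic.2 le_rfl)]
  have h1 : ∫ ω, X' (fun k => (St k ω, Ac k ω)) * W (St (t + 1) ω, Ac (t + 1) ω) ∂μ ≤
      ∫ ω, (b * Φ (fun k => (St k ω, Ac k ω)) + c * C) ∂μ := by
    refine integral_mono iX' ((iΦ.const_mul b).add (integrable_const _)) fun ω => ?_
    have h2 := mul_le_mul_of_nonneg_right (hXX' fun k => (St k ω, Ac k ω))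
      (hW (St (t + 1) ω, Ac (t + 1) ω))
    have h3 := mul_le_mul_of_nonneg_left (hWC (St (t + 1) ω, Ac (t + 1) ω)) hc0
    simp only [Φ] at h2 ⊢
    linarith
  rw [integral_add (iΦ.const_mul b) (integrable_const _), integral_const_mul,
    hc.integral_eq_integral_stepMean hΦ] at h1
  simp only [integral_const, probReal_univ, one_smul] at h1
  have h4 : ∫ ω, M.stepMean t Φ (fun k => (St k ω, Ac k ω)) ∂μ ≤
      ∫ ω, θ * (X (fun k => (St k ω, Ac k ω)) * U (St t ω, Ac t ω)) ∂μ := by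
    refine integral_mono (hc.integrable_of_dependsOn (M.dependsOn_stepMean hΦ))
      (iX.const_mul θ) fun ω => ?_
    set z : ℕ → S × A := fun k => (St k ω, Ac k ω) with hz
    have h5 : M.stepMean t Φ z =
        X z * ∑ z', M.kernel (z t) z' * (M.gam z'.1 * M.ratio (z t).1 (z t).2 * W z') := by
      simp only [stepMean, Φ]
      rw [Finset.mul_sum]
      refine Finset.sum_congr rfl fun z' _ => ?_
      rw [hX (y := z) fun k hk => Function.update_of_ne (by have := Set.mem_Iic.1 hk; omega) _ _]
      simp only [Function.update_self, Function.update_of_ne (show t ≠ t + 1 by omega)]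
      ring
    have h6 := mul_le_mul_of_nonneg_left (hUW (z t)) (hX0 z)
    calc _ = _ := h5
      _ ≤ _ := h6
      _ = θ * (X z * U (z t)) := by ring
  rw [integral_const_mul] at h4
  have h7 := mul_le_mul_of_nonneg_left h4 hb
  linarith

end EmphaticModel.IsBehaviorChain

namespace EmphaticModel.IsBehaviorChain

variable {S A : Type*} [Fintype S] [DecidableEq S] [MeasurableSpace S] [MeasurableSingletonClass S]
  [Fintype A] [MeasurableSpace A] [MeasurableSingletonClass A] {n : ℕ}
  {M : EmphaticModel S A n} {Ω : Type*} [MeasurableSpace Ω] {μ : Measure Ω}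
  [IsProbabilityMeasure μ] {St : ℕ → Ω → S} {Ac : ℕ → Ω → A}

/-- The traces are bounded in `L¹`, and traces restarted from zero approach them at a geometric
rate that is uniform in the time of the restart. -/
theorem exists_traces_bound (hc : M.IsBehaviorChain μ St Ac) (hM : M.PolicyCondition)
    (y₀ : TraceSpace n) :
    ∃ B θ : ℝ, 0 ≤ θ ∧ θ < 1 ∧
      (∀ t, ∫ ω, ‖M.pathTraces y₀ (fun k => (St k ω, Ac k ω)) t‖ ∂μ ≤ B) ∧
      ∀ r K, ∫ ω, ‖M.pathTraces y₀ (fun k => (St k ω, Ac k ω)) (r + (K + 1)) -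
        M.pathTraces 0 (fun k => (St (r + k) ω, Ac (r + k) ω)) (K + 1)‖ ∂μ ≤ B * θ ^ K := by
  obtain ⟨U, β, hβ0, hβ1, hU0, hUU, hU1⟩ := hM.exists_lyapunov
  obtain ⟨CU, hCU⟩ := (Set.finite_range U).bddAbove
  have hUC : ∀ z, U z ≤ max CU 0 := fun z => (hCU ⟨z, rfl⟩).trans (le_max_left _ _)
  have hUC0 : 0 ≤ max CU 0 := le_max_right _ _
  set C := max CU 0
  obtain ⟨Cf, hCf⟩ := (Set.finite_range fun s => ‖M.feature s‖).bddAbove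
  -- There is room for the loss `b > 1` because `β < 1` strictly.
  obtain ⟨b, hb1, hbβ⟩ : ∃ b : ℝ, 1 < b ∧ b * β < 1 :=
    ⟨1 + (1 - β) / 2, by linarith, by nlinarith⟩
  obtain ⟨κ, hκ1, hκ⟩ : ∃ κ : ℝ, 1 ≤ κ ∧ Cf ≤ (b - 1) * κ := by
    refine ⟨max 1 (Cf / (b - 1)), le_max_left _ _, ?_⟩
    rw [← div_le_iff₀' (by linarith)]
    exact le_max_right _ _
  have hκ0 : 0 ≤ κ := zero_le_one.trans hκ1
  have hb0 : 0 ≤ b := zero_le_one.trans hb1.le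
  have hstep := M.weightedNorm_traceStep_sub_le hb1.le (fun s => hCf ⟨s, rfl⟩) hκ
  obtain ⟨c', hc'⟩ := (Set.finite_range fun p : (S × A) × S =>
    weightedNorm κ (M.traceStep p.1 p.2 0)).bddAbove
  have hcc : ∀ z s', weightedNorm κ (M.traceStep z s' 0) ≤ max c' 0 := fun z s' =>
    (hc' ⟨(z, s'), rfl⟩).trans (le_max_left _ _)
  have hc0 : 0 ≤ max c' 0 := le_max_right _ _
  set c := max c' 0
  set θ := b * β with hθ
  have hθ0 : 0 ≤ θ := mul_nonneg hb0 hβ0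
  let X : ℕ → (ℕ → S × A) → ℝ := fun t z => weightedNorm κ (M.pathTraces y₀ z t)
  have hX : ∀ t, DependsOn (X t) (Set.Iic t) := fun t z w h =>
    congrArg (weightedNorm κ) (M.dependsOn_pathTraces y₀ t h)
  have hX0 : ∀ t z, 0 ≤ X t z := fun t z => weightedNorm_nonneg hκ0 _
  have hXs : ∀ t z, X (t + 1) z ≤
      b * (M.gam (z (t + 1)).1 * M.ratio (z t).1 (z t).2) * X t z + c := by
    intro t z
    simp only [X, pathTraces_succ]
    have h1 := weightedNorm_add_le hκ0
      (M.traceStep (z t) (z (t + 1)).1 (M.pathTraces y₀ z t) - M.traceStep (z t) (z (t + 1)).1 0)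
      (M.traceStep (z t) (z (t + 1)).1 0)
    rw [sub_add_cancel] at h1
    have h2 := hstep (z t) (z (t + 1)).1 (M.pathTraces y₀ z t) 0
    rw [sub_zero] at h2
    linarith [hcc (z t) (z (t + 1)).1]
  let I : ℕ → ℝ := fun t =>
    ∫ ω, X t (fun k => (St k ω, Ac k ω)) * U (St t ω, Ac t ω) ∂μ
  have hI0 : ∀ t, 0 ≤ I t := fun t => integral_nonneg fun ω => mul_nonneg (hX0 _ _) (hU0 _)
  have hIs : ∀ t, I (t + 1) ≤ θ * I t + c * C := fun t =>
    hc.integral_le_of_kernel_le hb0 hc0 (hX t) (hX (t + 1)) (hX0 t) hU0 hUC hUU (hXs t)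
  have hcC : 0 ≤ c * C := mul_nonneg hc0 hUC0
  obtain ⟨J, hJ⟩ : ∃ J, ∀ t, I t ≤ J := by
    -- The second summand is the fixed point of `x ↦ θ * x + c * C`.
    refine ⟨I 0 + c * C / (1 - θ), fun t => ?_⟩
    have h1 : c * C / (1 - θ) = θ * (c * C / (1 - θ)) + c * C := by
      have : (1 - θ) ≠ 0 := by linarith
      field_simp
      ring
    have h2 : 0 ≤ c * C / (1 - θ) := div_nonneg hcC (by linarith)
    induction t with
    | zero => linarith
    | succ t ih =>
      have h3 := mul_le_mul_of_nonneg_left ih hθ0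
      have h4 := mul_le_of_le_one_left (hI0 0) hbβ.le
      linarith [hIs t]
  have hJ0 : 0 ≤ J := (hI0 0).trans (hJ 0)
  have hE : ∀ t, ∫ ω, X (t + 1) (fun k => (St k ω, Ac k ω)) ∂μ ≤ b * J + c := by
    intro t
    have h1 := hc.integral_le_of_kernel_le (U := U) (W := fun _ => 1) (C := 1) hb0 hc0 (hX t)
      (hX (t + 1)) (hX0 t) (fun _ => zero_le_one) (fun _ => le_rfl) hU1 (hXs t)
    simp only [mul_one] at h1
    exact h1.trans (add_le_add (mul_le_mul_of_nonneg_left (hJ t) hb0) le_rfl)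
  have iY : ∀ t, Integrable (fun ω => ‖M.pathTraces y₀ (fun k => (St k ω, Ac k ω)) t‖) μ :=
    fun t => (hc.integrable_of_dependsOn (M.dependsOn_pathTraces y₀ t)).norm
  refine ⟨max (max ‖y₀‖ (b * J + c)) (b * J), θ, hθ0, hbβ, fun t => ?_, fun r K => ?_⟩
  · refine le_trans ?_ (le_max_left _ _)
    rcases t with _ | t
    · simp [pathTraces_zero]
    · refine le_trans ?_ ((hE t).trans (le_max_right _ _))
      exact integral_mono (iY _) (hc.integrable_of_dependsOn (hX (t + 1))) fun ω =>
        norm_le_weightedNorm hκ1 _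
  -- Both traces follow the same steps, so their difference contracts with no additive term. At `j =
  -- 0` it is the trace at time `r`, whose weighted mean is at most `J` for every `r`.
  · let D : ℕ → (ℕ → S × A) → ℝ := fun j z =>
      weightedNorm κ (M.pathTraces y₀ z (r + j) - M.pathTraces 0 (fun k => z (r + k)) j)
    have hYD : ∀ j, DependsOn (fun z => M.pathTraces y₀ z (r + j) -
        M.pathTraces 0 (fun k => z (r + k)) j) (Set.Iic (r + j)) := fun j z w h =>
      congrArg₂ (· - ·) (M.dependsOn_pathTraces y₀ (r + j) h)
        (M.dependsOn_pathTraces 0 j fun k hk =>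
          h (r + k) (Set.mem_Iic.2 (Nat.add_le_add_left hk r)))
    have hD : ∀ j, DependsOn (D j) (Set.Iic (r + j)) := fun j z w h =>
      congrArg (weightedNorm κ) (hYD j h)
    have hD0 : ∀ j z, 0 ≤ D j z := fun j z => weightedNorm_nonneg hκ0 _
    have hDs : ∀ j z, D (j + 1) z ≤
        b * (M.gam (z (r + (j + 1))).1 * M.ratio (z (r + j)).1 (z (r + j)).2) * D j z + 0 := by
      intro j z
      have h1 := M.pathTraces_succ y₀ z (r + j)
      have h2 := M.pathTraces_succ 0 (fun k => z (r + k)) j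
      rw [add_assoc] at h1
      simp only [D, add_zero, h1, h2]
      exact hstep (z (r + j)) (z (r + (j + 1))).1 _ _
    have hDI : ∀ j, ∫ ω, D j (fun k => (St k ω, Ac k ω)) * U (St (r + j) ω, Ac (r + j) ω) ∂μ ≤
        θ ^ j * J := by
      intro j
      induction j with
      | zero =>
        rw [pow_zero, one_mul]
        refine le_trans (le_of_eq ?_) (hJ r)
        simp only [D, I, X, pathTraces_zero, sub_zero, add_zero]
      | succ j ih =>
        have h1 := hc.integral_le_of_kernel_le hb0 le_rfl (hD j) (hD (j + 1)) (hD0 j) hU0 hUC hUU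
          (hDs j)
        have h2 := mul_le_mul_of_nonneg_left ih hθ0
        rw [zero_mul, add_zero] at h1
        exact h1.trans (h2.trans_eq (by ring))
    -- Removing the weight uses up one step, hence `K + 1` steps for a factor `θ ^ K`.
    have h1 := hc.integral_le_of_kernel_le (U := U) (W := fun _ => 1) (C := 1) hb0 le_rfl (hD K)
      (hD (K + 1)) (hD0 K) (fun _ => zero_le_one) (fun _ => le_rfl) hU1 (hDs K)
    simp only [mul_one, add_zero] at h1
    calc _ ≤ ∫ ω, D (K + 1) (fun k => (St k ω, Ac k ω)) ∂μ :=
          integral_mono (hc.integrable_of_dependsOn (hYD (K + 1))).norm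
            (hc.integrable_of_dependsOn (hD (K + 1))) fun ω => norm_le_weightedNorm hκ1 _
      _ ≤ b * (θ ^ K * J) := h1.trans (mul_le_mul_of_nonneg_left (hDI K) hb0)
      _ = b * J * θ ^ K := by ring
      _ ≤ _ := mul_le_mul_of_nonneg_right (le_max_right _ _) (pow_nonneg hθ0 K)

end EmphaticModel.IsBehaviorChain

/-! ### Window approximation and the limit -/

namespace EmphaticModel

variable {S A : Type*} [Fintype S] [DecidableEq S] [MeasurableSpace S] [MeasurableSingletonClass S]
  [Fintype A] [MeasurableSpace A] [MeasurableSingletonClass A] {n : ℕ}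

theorem PolicyCondition.exists_averagesTo_pathInput {M : EmphaticModel S A n}
    (hM : M.PolicyCondition) (h : TraceSpace n → S → A → S → ℝ) {L : ℝ}
    (hLip : ∀ (y y' : TraceSpace n) (s : S) (a : A) (s' : S),
      |h y s a s' - h y' s a s'| ≤ L * ‖y - y'‖) :
    ∃ G, ∀ α : ℕ → ℝ, StepsizeCondition α →
      ∀ (Ω : Type*) [MeasurableSpace Ω] (μ : Measure Ω) [IsProbabilityMeasure μ]
        (St : ℕ → Ω → S) (Ac : ℕ → Ω → A), M.IsBehaviorChain μ St Ac →
      ∀ y₀ : TraceSpace n,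
        AveragesTo μ α (fun t ω => M.pathInput h y₀ t fun k => (St k ω, Ac k ω)) G 0 := by
  choose c hcw using fun K : ℕ => hM.exists_averagesTo_window (K + 1 + 1)
    (M.pathInput h 0 (K + 1)) (M.dependsOn_pathInput h 0 (K + 1))
  -- The constant must be named before any chain is given, while convergence of `c` is proved below
  -- with the help of a chain; `limUnder` is defined in any case.
  refine ⟨limUnder atTop c, fun α hα Ω _ μ _ St Ac hc y₀ => ?_⟩
  obtain ⟨B, θ, hθ0, hθ1, hB, hBθ⟩ := hc.exists_traces_bound hM y₀
  let X : ℕ → Ω → ℝ := fun t ω => M.pathInput h y₀ t fun k => (St k ω, Ac k ω)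
  have iX : ∀ t, Integrable (X t) μ := fun t =>
    hc.integrable_of_dependsOn (M.dependsOn_pathInput h y₀ t)
  have hLip' : ∀ (y y' : TraceSpace n) (s : S) (a : A) (s' : S),
      |h y s a s' - h y' s a s'| ≤ |L| * ‖y - y'‖ := fun y y' s a s' =>
    (hLip y y' s a s').trans (mul_le_mul_of_nonneg_right (le_abs_self L) (norm_nonneg _))
  obtain ⟨C, hC⟩ := (Set.finite_range fun p : S × A × S => |h 0 p.1 p.2.1 p.2.2|).bddAbove
  have hXB : ∀ t, ∫ ω, |X t ω| ∂μ ≤ C + |L| * B := by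
    intro t
    have iY : Integrable (fun ω => ‖M.pathTraces y₀ (fun k => (St k ω, Ac k ω)) t‖) μ :=
      (hc.integrable_of_dependsOn (M.dependsOn_pathTraces y₀ t)).norm
    have h1 : ∫ ω, |X t ω| ∂μ ≤
        ∫ ω, (C + |L| * ‖M.pathTraces y₀ (fun k => (St k ω, Ac k ω)) t‖) ∂μ := by
      refine integral_mono (iX t).abs ((integrable_const C).add (iY.const_mul _)) fun ω => ?_
      have h2 := hLip' (M.pathTraces y₀ (fun k => (St k ω, Ac k ω)) t) 0 (St t ω) (Ac t ω)
        (St (t + 1) ω)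
      have h3 : |h 0 (St t ω) (Ac t ω) (St (t + 1) ω)| ≤ C :=
        hC ⟨(St t ω, Ac t ω, St (t + 1) ω), rfl⟩
      have h4 := abs_sub_abs_le_abs_sub (X t ω) (h 0 (St t ω) (Ac t ω) (St (t + 1) ω))
      rw [sub_zero] at h2
      have h5 := h4.trans h2
      simp only
      linarith
    rw [integral_add (integrable_const C) (iY.const_mul _), integral_const_mul] at h1
    simp only [integral_const, probReal_univ, one_smul] at h1
    exact h1.trans (add_le_add le_rfl (mul_le_mul_of_nonneg_left (hB t) (abs_nonneg L)))
  -- After a shift by `K + 1`, the input is a window function plus the error of restarting the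
  -- traces at time `t`.
  have hK : ∀ K, AveragesTo μ α X (c K) (|L| * (B * θ ^ K)) := by
    intro K
    refine AveragesTo.of_add_nat hα iX hXB (K + 1) ?_
    let W : ℕ → Ω → ℝ := fun t ω =>
      M.pathInput h 0 (K + 1) fun k => (St (t + k) ω, Ac (t + k) ω)
    have iW : ∀ t, Integrable (W t) μ :=
      hc.integrable_shift (M.dependsOn_pathInput h 0 (K + 1))
    have iXW : ∀ t, Integrable (fun ω => X (t + (K + 1)) ω - W t ω) μ := fun t =>
      (iX (t + (K + 1))).sub (iW t)
    have h1 : AveragesTo μ α (fun t ω => X (t + (K + 1)) ω - W t ω) 0 (|L| * (B * θ ^ K)) := by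
      refine averagesTo_of_integral_abs_sub_le hα iXW fun t => ?_
      have iYD : Integrable (fun ω => M.pathTraces y₀ (fun k => (St k ω, Ac k ω)) (t + (K + 1)) -
          M.pathTraces 0 (fun k => (St (t + k) ω, Ac (t + k) ω)) (K + 1)) μ :=
        (hc.integrable_of_dependsOn (M.dependsOn_pathTraces y₀ (t + (K + 1)))).sub
          (hc.integrable_shift (M.dependsOn_pathTraces 0 (K + 1)) t)
      refine le_trans ?_ (mul_le_mul_of_nonneg_left (hBθ t K) (abs_nonneg L))
      rw [← integral_const_mul]
      refine integral_mono ((iXW t).sub (integrable_const 0)).abs (iYD.norm.const_mul _)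
        fun ω => ?_
      simp only [sub_zero]
      exact hLip' _ _ _ _ _
    have h2 := (hcw K α hα Ω μ St Ac hc).add iW iXW h1
    rw [add_zero, zero_add] at h2
    exact h2.congr_fun fun t ω => by simp only [W]; ring
  have hlim : Tendsto (fun K => |L| * (B * θ ^ K)) atTop (𝓝 0) := by
    simpa using ((tendsto_pow_atTop_nhds_zero_of_lt_one hθ0 hθ1).const_mul B).const_mul |L|
  -- All `c K` approximate the averages of the same input `X`, so two of them differ by at most the
  -- sum of their errors.
  have hcauchy : CauchySeq c := by
    rw [Metric.cauchySeq_iff']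
    intro ε hε
    obtain ⟨N, hN⟩ := eventually_atTop.1 (hlim.eventually (gt_mem_nhds (half_pos hε)))
    refine ⟨N, fun k hk => ?_⟩
    rw [Real.dist_eq]
    have := (hK k).unique iX (hK N)
    linarith [hN k hk, hN N le_rfl]
  have hG := hcauchy.tendsto_limUnder
  have hG' : Tendsto (fun K => |L| * (B * θ ^ K) + |c K - limUnder atTop c|) atTop (𝓝 0) := by
    have := hlim.add (hG.sub_const (limUnder atTop c)).abs
    simpa using this
  intro g δ hδ
  obtain ⟨K, hKδ⟩ := (hG'.eventually (gt_mem_nhds (half_pos hδ))).exists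
  filter_upwards [(hK K).of_dist iX hα (limUnder atTop c) g (δ / 2) (half_pos hδ)] with t ht
  linarith

end EmphaticModel

theorem mainTheorem5 {S A : Type*} [Fintype S] [DecidableEq S] [MeasurableSpace S]
    [MeasurableSingletonClass S] [Fintype A] [MeasurableSpace A] [MeasurableSingletonClass A]
    {n m : ℕ} (M : EmphaticModel S A n) (hM : M.PolicyCondition)
    (h : TraceSpace n → S → A → S → Fin m → ℝ)
    (hLip : ∃ L : ℝ, ∀ (y y' : TraceSpace n) (s : S) (a : A) (s' : S),
      ‖h y s a s' - h y' s a s'‖ ≤ L * ‖y - y'‖) :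
    ∃ Gstar : Fin m → ℝ,
      ∀ α : ℕ → ℝ, StepsizeCondition α →
      ∀ (Ω : Type*) [MeasurableSpace Ω] (μ : Measure Ω) [IsProbabilityMeasure μ]
        (St : ℕ → Ω → S) (Ac : ℕ → Ω → A), M.IsBehaviorChain μ St Ac →
      ∀ (y₀ : TraceSpace n) (g₀ : Fin m → ℝ),
        (∀ t, Integrable
          (fun ω => M.averaging h α y₀ g₀ (fun k => St k ω) (fun k => Ac k ω) t) μ) ∧
        Tendsto
          (fun t => ∫ ω,
            ‖M.averaging h α y₀ g₀ (fun k => St k ω) (fun k => Ac k ω) t - Gstar‖ ∂μ)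
          atTop (𝓝 0) := by
  obtain ⟨L, hL⟩ := hLip
  choose G hG using fun i : Fin m => hM.exists_averagesTo_pathInput
    (fun y s a s' => h y s a s' i) (L := L) fun y y' s a s' =>
      (norm_le_pi_norm (h y s a s' - h y' s a s') i).trans (hL y y' s a s')
  refine ⟨G, fun α hα Ω _ μ _ St Ac hc y₀ g₀ => ?_⟩
  -- The recursion decouples into coordinates, and the maximum norm is at most the sum of their
  -- absolute values.
  have hcoord : ∀ t ω i, M.averaging h α y₀ g₀ (fun k => St k ω) (fun k => Ac k ω) t i =
      weightedAvg α (g₀ i) (fun t => M.pathInput (fun y s a s' => h y s a s' i) y₀ t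
        fun k => (St k ω, Ac k ω)) t := by
    intro t ω i
    induction t with
    | zero => rfl
    | succ t ih =>
      simp only [EmphaticModel.averaging, weightedAvg, Pi.add_apply, Pi.smul_apply, smul_eq_mul, ih]
      rfl
  have hint : ∀ i t, Integrable (fun ω => weightedAvg α (g₀ i) (fun t =>
      M.pathInput (fun y s a s' => h y s a s' i) y₀ t fun k => (St k ω, Ac k ω)) t) μ := fun i t =>
    integrable_weightedAvg (X := fun t ω => M.pathInput (fun y s a s' => h y s a s' i) y₀ t
      fun k => (St k ω, Ac k ω))
      (fun t => hc.integrable_of_dependsOn (M.dependsOn_pathInput _ y₀ t)) _ t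
  have hI : ∀ t, Integrable
      (fun ω => M.averaging h α y₀ g₀ (fun k => St k ω) (fun k => Ac k ω) t) μ := fun t =>
    Integrable.of_eval fun i => by simpa only [hcoord] using hint i t
  refine ⟨hI, ?_⟩
  have hsum : Tendsto (fun t => ∑ i, ∫ ω, |weightedAvg α (g₀ i) (fun t =>
      M.pathInput (fun y s a s' => h y s a s' i) y₀ t fun k => (St k ω, Ac k ω)) t - G i| ∂μ)
      atTop (𝓝 (∑ _ : Fin m, 0)) :=
    tendsto_finsetSum _ fun i _ => (hG i α hα Ω μ St Ac hc y₀).tendsto (g₀ i)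
  rw [Finset.sum_const_zero] at hsum
  refine squeeze_zero (fun t => integral_nonneg fun ω => norm_nonneg _) (fun t => ?_) hsum
  have habs : ∀ i, Integrable (fun ω => |weightedAvg α (g₀ i) (fun t =>
      M.pathInput (fun y s a s' => h y s a s' i) y₀ t fun k => (St k ω, Ac k ω)) t - G i|) μ :=
    fun i => ((hint i t).sub (integrable_const _)).abs
  rw [← integral_finsetSum _ fun i _ => habs i]
  refine integral_mono ((hI t).sub (integrable_const G)).norm
    (integrable_finsetSum _ fun i _ => habs i) fun ω => ?_
  refine (pi_norm_le_iff_of_nonneg (Finset.sum_nonneg fun i _ => abs_nonneg _)).2 fun i => ?_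
  rw [Pi.sub_apply, hcoord, Real.norm_eq_abs]
  exact Finset.single_le_sum (f := fun i => |weightedAvg α (g₀ i) (fun t =>
    M.pathInput (fun y s a s' => h y s a s' i) y₀ t fun k => (St k ω, Ac k ω)) t - G i|)
    (fun i _ => abs_nonneg _) (Finset.mem_univ i)
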